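/- **Setting.** Let $n,N\ge 1$, let $\mathbf A\in\mathbb R^{n\times n}$ have ones on the superdiagonal and zeros elsewhere, $B=(0,\dots,0,1)^\top$, $C=(1,0,\dots,0)$, $\mathbf D_c=\operatorname{diag}\{n,n-1,\dots,1\}$ and $\mathbf\Lambda_r=\operatorname{diag}\{r^n,r^{n-1},\dots,r\}$. Let $\mathcal G$ be a connected undirected graph on the followers $1,\dots,N$ with adjacency matrix $(a_{k,j})$ and Laplacian $\mathcal L_{\mathcal G}$, let $\mathsf b_k\in\{0,1\}$ be $1$ exactly when follower $k$ is a neighbour of the leader (at least one is), and $\mathcal L_{\bar{\mathcal G}}=\mathcal L_{\mathcal G}+\operatorname{diag}\{\mathsf b_1,\dots,\mathsf b_N\}$. Let the row vectors $K,G\in\mathbb R^{1\times n}$ be such that $$\mathbf A_c=\mathbf I_N\otimes\mathbf A-\mathcal L_{\bar{\mathcal G}}\otimes(BK),\qquad \mathbf A_0=\mathbf I_N\otimes(\mathbf A-G^\top C)$$ are Hurwitz, let $c_1\in(0,1)$, and let $\mathbf P_c,\mathbf P_0$ be symmetric positive definite with $$c_1(\mathbf P_c\mathbf A_c+\mathbf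 A_c^\top\mathbf P_c)\le-2\mathbf I_{nN},\qquad \mathbf P_0\mathbf A_0+\mathbf A_0^\top\mathbf P_0\le-\mathbf I_{nN}.$$ Put $\mathbf A_g=\mathbf I_N\otimes(G^\top C)$, and let $|\cdot|$ be the Euclidean norm of a vector and the Frobenius norm of a matrix. Let $\varrho_{k,j}$ (growth rates), $\Delta_{\theta_k}\in(0,1)$, $t_f>0$ and $\delta>0$ be given, with $$0<\max\{\Delta_{\theta_1},\dots,\Delta_{\theta_N}\}\le \frac1{|\mathbf P_c\mathbf A_g|}.$$ **Closed loop.** For $b>0$ let $r(t)=b\,\alpha_0(t)$ with $\alpha_0(t)=\frac1{t_f+\delta-t}$ on $[0,t_f)$ and $\alpha_0(t)=\frac1\delta$ on $[t_f,\infty)$. The leader has state $x_0$ with $\dot x_0=\mathbf Ax_0+F_0(t,x_0)$ on $[0,\infty)$; follower $k$ has state $x_k$, nonlinearity $F_k=(f_{k,1},\dots,f_{k,n})^\top$ and sensor sensitivity $\theta_k$; $\hat x_0,\hat x_k$ are observer states. With $e_k=x_k-x_0$, $\hat\eta_k=\mathbf\Lambda_r(\hat x_k-\hat x_0)$, $\varepsilon_k=\mathbf\Lambda_r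 e_k-\hat\eta_k$, $\Phi_k=\big(r^{n-i}(f_{k,i}(t,x_k)-f_{0,i}(t,x_0))\big)_{i=1}^n$ and the protocol $$u_k=-K\mathbf\Lambda_r\Big(\sum_{j=1}^N a_{k,j}(\hat x_k-\hat x_j)+\mathsf b_k(\hat x_k-\hat x_0)\Big),$$ the closed loop is the system, for $k=1,\dots,N$, $$\dot{\hat\eta}_k=r\big(\mathbf A\hat\eta_k+Bu_k+G^\top\theta_k\varepsilon_{k,1}+G^\top(\theta_k-1)\hat\eta_{k,1}\big)+\tfrac{\dot r}{r}\mathbf D_c\hat\eta_k,\qquad \dot\varepsilon_k=r\big((\mathbf A-G^\top C)\varepsilon_k+\Phi_k\big)+\tfrac{\dot r}{r}\mathbf D_c\varepsilon_k .$$ Solutions on an interval $[t_0,S)$, $S\le\infty$, are such that all $\hat\eta_k,\varepsilon_k$ are continuous and satisfy the equations for all $t\in(t_0,S)$ outside a set of times that is finite in every bounded interval. It is assumed that, for all $t\ge0$, all $k$, $i$ and all $\xi\in\mathbb R^n$, $$|f_{k,i}(t,\xi)-f_{0,i}(t,x_0(t))|\le\sum_{j=1}^i\varrho_{k,j}|\xi_j-x_{0,j}(t)|,$$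 and that each $\theta_k$ is continuous with $\theta_k(t)\in[1-\Delta_{\theta_k},1+\Delta_{\theta_k}]$. Let $V=\hat\eta^\top\mathbf P_c\hat\eta+c\,\varepsilon^\top\mathbf P_0\varepsilon$, where $\hat\eta$ and $\varepsilon$ stack the $\hat\eta_k$ and the $\varepsilon_k$. **Theorem 3.** There is $c>0$ such that for every $\gamma>0$ there is $b\ge t_f+\delta$ for which the following holds for all $F_0,F_k,\theta_k$ and leader trajectories $x_0$ as above. 1) The closed loop is (globally, uniformly) asymptotically stable on $[0,\infty)$: there is a class $\mathcal{KL}$ function $\beta$, the same for all these data, such that every solution on an interval $[t_0,S)$, $0\le t_0$, $S\le\infty$, satisfies $|(\hat\eta,\varepsilon)(t)|\le\beta\big(|(\hat\eta,\varepsilon)(t_0)|,t-t_0\big)$ for all $t\in[t_0,S)$. 2) For every solution on $[0,S)$ with $S>t_f$ and every $k$, the tracking error $e_k$ converges as $t\to t_f$ to the compact set $$\Omega=\left\{e\in\mathbb R^n:\ |e|\le\frac{2\delta\sqrt{V(0)}\,\big(\frac{\delta}{t_f+\delta}\big)^{\gamma/2}}{b\sqrt{\min\{\lambda_{\min}(\mathbf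 P_c),\,c\,\lambda_{\min}(\mathbf P_0)\}}}\right\},$$ and $e_k(t)\in\Omega$ for all $t\in[t_f,S)$. -/

import Mathlib

open Filter Topology Set Matrix
open scoped Kronecker

noncomputable section

namespace PrescribedTime

/-! ### Matrices of the agents and of the network.
Stacked vectors are indexed by `(k, i)`, `k` the follower and `i` the coordinate. Coordinates are
numbered from `0`, so the `i`-th coordinate of the usual numbering has index `i - 1`. -/

/-- The `n × n` matrix `A` of a chain of integrators: ones on the superdiagonal. -/
def chainA (n : ℕ) : Matrix (Fin n) (Fin n) ℝ :=
  Matrix.of fun i j => if (j : ℕ) = (i : ℕ) + 1 then 1 else 0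

/-- The input vector `B = (0, …, 0, 1)ᵀ`. -/
def inputB (n : ℕ) : Fin n → ℝ := fun i => if (i : ℕ) + 1 = n then 1 else 0

/-- The output row `C = (1, 0, …, 0)`. -/
def outputC (n : ℕ) [NeZero n] : Fin n → ℝ := Pi.single 0 1

/-- `Λ_r = diag(rⁿ, rⁿ⁻¹, …, r)`. -/
def scaling (n : ℕ) (r : ℝ) : Matrix (Fin n) (Fin n) ℝ :=
  Matrix.diagonal fun i => r ^ (n - (i : ℕ))

/-- `D_c = diag(n, n - 1, …, 1)`. -/
def weightD (n : ℕ) : Matrix (Fin n) (Fin n) ℝ :=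
  Matrix.diagonal fun i => (n : ℝ) - (i : ℕ)

/-- The Laplacian of the follower graph plus the diagonal 0-1 matrix of the followers that are
neighbours of the leader (those in `pin`). -/
def leaderLaplacian {N : ℕ} (Gr : SimpleGraph (Fin N)) [DecidableRel Gr.Adj]
    (pin : Finset (Fin N)) : Matrix (Fin N) (Fin N) ℝ :=
  Gr.lapMatrix ℝ + Matrix.diagonal fun k => if k ∈ pin then 1 else 0

/-- `A_c = I_N ⊗ A - L ⊗ (B K)`. -/
def closedA {N n : ℕ} (Gr : SimpleGraph (Fin N)) [DecidableRel Gr.Adj]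
    (pin : Finset (Fin N)) (K : Fin n → ℝ) :
    Matrix (Fin N × Fin n) (Fin N × Fin n) ℝ :=
  (1 : Matrix (Fin N) (Fin N) ℝ) ⊗ₖ chainA n
    - leaderLaplacian Gr pin ⊗ₖ Matrix.vecMulVec (inputB n) K

/-- `A_0 = I_N ⊗ (A - Gᵀ C)`. -/
def observerA (N : ℕ) {n : ℕ} [NeZero n] (G : Fin n → ℝ) :
    Matrix (Fin N × Fin n) (Fin N × Fin n) ℝ :=
  (1 : Matrix (Fin N) (Fin N) ℝ) ⊗ₖ (chainA n - Matrix.vecMulVec G (outputC n))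

/-- `A_g`, block diagonal with `N` blocks `[Gᵀ, 0, …, 0]`. -/
def gainA (N : ℕ) {n : ℕ} [NeZero n] (G : Fin n → ℝ) :
    Matrix (Fin N × Fin n) (Fin N × Fin n) ℝ :=
  (1 : Matrix (Fin N) (Fin N) ℝ) ⊗ₖ Matrix.vecMulVec G (outputC n)

/-- All complex eigenvalues have negative real part. -/
def IsHurwitz {ι : Type*} [Fintype ι] [DecidableEq ι] (M : Matrix ι ι ℝ) : Prop :=
  ∀ z ∈ spectrum ℂ (M.map (algebraMap ℝ ℂ)), z.re < 0

/-- Frobenius norm. -/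
def frobNorm {ι κ : Type*} [Fintype ι] [Fintype κ] (M : Matrix ι κ ℝ) : ℝ :=
  Real.sqrt (∑ i, ∑ j, M i j ^ 2)

/-- Smallest eigenvalue of a symmetric matrix. -/
def lambdaMin {ι : Type*} [Fintype ι] [DecidableEq ι] {M : Matrix ι ι ℝ}
    (hM : M.IsHermitian) : ℝ :=
  ⨅ i, hM.eigenvalues i

/-! ### The time-varying gain -/

/-- The saturated function `α₀`. -/
def alphaSat (tf δ t : ℝ) : ℝ := if t < tf then 1 / (tf + δ - t) else 1 / δ

/-- The gain `r = b α₀`. -/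
def gain (b tf δ t : ℝ) : ℝ := b * alphaSat tf δ t

/-! ### Signals, assumptions, closed loop -/

/-- State of the leader, states of the followers, and the corresponding observer states. -/
structure Signals (N n : ℕ) where
  x₀ : ℝ → Fin n → ℝ
  xhat₀ : ℝ → Fin n → ℝ
  x : Fin N → ℝ → Fin n → ℝ
  xhat : Fin N → ℝ → Fin n → ℝ

/-- A set of times that meets every bounded interval in a finite set. -/
def IsLocallyFinite (E : Set ℝ) : Prop := ∀ a b : ℝ, (E ∩ Icc a b).Finite

/-- The leader moves by `ẋ₀ = A x₀ + F₀(t, x₀)` on `[0, ∞)`, in the sense appropriate to a right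
hand side that is piecewise continuous in time. -/
def IsLeaderTrajectory {n : ℕ} (F₀ : ℝ → (Fin n → ℝ) → Fin n → ℝ) (x₀ : ℝ → Fin n → ℝ) : Prop :=
  ContinuousOn x₀ (Ici 0) ∧ ∃ E : Set ℝ, IsLocallyFinite E ∧
    ∀ t, 0 < t → t ∉ E → HasDerivAt x₀ (chainA n *ᵥ x₀ t + F₀ t (x₀ t)) t

/-- Growth assumption on the nonlinearities: for every time and every state `ξ` of follower `k`,
compared with the leader at that time. -/
def GrowthBound {N n : ℕ} (ϱ : Fin N → Fin n → ℝ) (F₀ : ℝ → (Fin n → ℝ) → Fin n → ℝ)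
    (F : Fin N → ℝ → (Fin n → ℝ) → Fin n → ℝ) (x₀ : ℝ → Fin n → ℝ) : Prop :=
  ∀ t, 0 ≤ t → ∀ k ξ i,
    |F k t ξ i - F₀ t (x₀ t) i| ≤ ∑ j ∈ Finset.Iic i, ϱ k j * |ξ j - x₀ t j|

/-- The sensor sensitivities are continuous with values in `[1 - Δ_k, 1 + Δ_k]`. -/
def SensitivityBound {N : ℕ} (Δ : Fin N → ℝ) (θ : Fin N → ℝ → ℝ) : Prop :=
  ∀ k, ContinuousOn (θ k) (Ici 0) ∧ ∀ t, 0 ≤ t → θ k t ∈ Icc (1 - Δ k) (1 + Δ k)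

section ClosedLoop

variable {N n : ℕ}

/-- Tracking error `e_k = x_k - x₀`. -/
def trackingError (s : Signals N n) (k : Fin N) (t : ℝ) : EuclideanSpace ℝ (Fin n) :=
  WithLp.toLp 2 (s.x k t - s.x₀ t)

/-- `η̂_k = Λ_r (x̂_k - x̂₀)`, for the time-varying gain `r`. -/
def etaHat (r : ℝ → ℝ) (s : Signals N n) (k : Fin N) (t : ℝ) : Fin n → ℝ :=
  scaling n (r t) *ᵥ (s.xhat k t - s.xhat₀ t)

/-- `ε_k = Λ_r (x_k - x₀) - η̂_k`. -/
def epsErr (r : ℝ → ℝ) (s : Signals N n) (k : Fin N) (t : ℝ) : Fin n → ℝ :=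
  scaling n (r t) *ᵥ (s.x k t - s.x₀ t) - etaHat r s k t

/-- The distributed protocol
`u_k = -K Λ_r (∑ⱼ a_{kj} (x̂_k - x̂_j) + b_k (x̂_k - x̂₀))`. -/
def control (Gr : SimpleGraph (Fin N)) [DecidableRel Gr.Adj] (pin : Finset (Fin N))
    (K : Fin n → ℝ) (r : ℝ → ℝ) (s : Signals N n) (k : Fin N) (t : ℝ) : ℝ :=
  -(K ⬝ᵥ (scaling n (r t) *ᵥ
      ((∑ j, Gr.adjMatrix ℝ k j • (s.xhat k t - s.xhat j t))
        + (if k ∈ pin then (1 : ℝ) else 0) • (s.xhat k t - s.xhat₀ t))))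

/-- `Φ_k`, with components `r^{n-i} (f_{k,i}(t, x_k) - f_{0,i}(t, x₀))`, `i = 1, …, n`. -/
def phi (F₀ : ℝ → (Fin n → ℝ) → Fin n → ℝ) (F : Fin N → ℝ → (Fin n → ℝ) → Fin n → ℝ)
    (r : ℝ → ℝ) (s : Signals N n) (k : Fin N) (t : ℝ) : Fin n → ℝ :=
  fun i => r t ^ (n - 1 - (i : ℕ)) * (F k t (s.x k t) i - F₀ t (s.x₀ t) i)

/-- The signals follow the closed-loop dynamics on `[t₀, S)`, `S ≤ ∞`. The equations are written
in the original time `t`; where the gain is not saturated, `dτ/dt = α₀ = ṙ / r` turns them into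
`dη̂_k/dτ = b (A η̂_k + B u_k) + D_c η̂_k + b Gᵀ θ_k ε_{k,1} + b Gᵀ (θ_k - 1) η̂_{k,1}` and
`dε_k/dτ = b ((A - Gᵀ C) ε_k + Φ_k) + D_c ε_k`; where it is saturated, `ṙ = 0`.
The equations may fail at a locally finite set of times (such as the corner of the gain and the
jumps of the nonlinearities), where the errors are still continuous. -/
def IsClosedLoop [NeZero n] (Gr : SimpleGraph (Fin N)) [DecidableRel Gr.Adj]
    (pin : Finset (Fin N)) (K G : Fin n → ℝ) (F₀ : ℝ → (Fin n → ℝ) → Fin n → ℝ)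
    (F : Fin N → ℝ → (Fin n → ℝ) → Fin n → ℝ) (θ : Fin N → ℝ → ℝ) (r : ℝ → ℝ)
    (t₀ : ℝ) (S : EReal) (s : Signals N n) : Prop :=
  (∀ k, ContinuousOn (etaHat r s k) {t | t₀ ≤ t ∧ (t : EReal) < S} ∧
    ContinuousOn (epsErr r s k) {t | t₀ ≤ t ∧ (t : EReal) < S}) ∧
  ∃ E : Set ℝ, IsLocallyFinite E ∧ ∀ t, t₀ < t → (t : EReal) < S → t ∉ E → ∀ k,
    HasDerivAt (etaHat r s k)
      (r t • (chainA n *ᵥ etaHat r s k t + control Gr pin K r s k t • inputB n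
          + (θ k t * epsErr r s k t 0) • G + ((θ k t - 1) * etaHat r s k t 0) • G)
        + (deriv r t / r t) • (weightD n *ᵥ etaHat r s k t)) t ∧
    HasDerivAt (epsErr r s k)
      (r t • ((chainA n - Matrix.vecMulVec G (outputC n)) *ᵥ epsErr r s k t + phi F₀ F r s k t)
        + (deriv r t / r t) • (weightD n *ᵥ epsErr r s k t)) t

/-- Euclidean norm of the closed-loop state `(η̂, ε)`. -/
def stateNorm (r : ℝ → ℝ) (s : Signals N n) (t : ℝ) : ℝ :=
  Real.sqrt (∑ k, ∑ i, (etaHat r s k t i ^ 2 + epsErr r s k t i ^ 2))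

/-- `V = η̂ᵀ P_c η̂ + c εᵀ P₀ ε`, with `η̂` and `ε` stacked over the followers. -/
def lyapV (Pc P₀ : Matrix (Fin N × Fin n) (Fin N × Fin n) ℝ) (c : ℝ)
    (r : ℝ → ℝ) (s : Signals N n) (t : ℝ) : ℝ :=
  (fun p : Fin N × Fin n => etaHat r s p.1 t p.2) ⬝ᵥ
      (Pc *ᵥ fun p : Fin N × Fin n => etaHat r s p.1 t p.2)
    + c * ((fun p : Fin N × Fin n => epsErr r s p.1 t p.2) ⬝ᵥ
      (P₀ *ᵥ fun p : Fin N × Fin n => epsErr r s p.1 t p.2))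

end ClosedLoop

/-- Class `𝒦ℒ` functions on `[0, ∞) × [0, ∞)`. -/
structure IsClassKL (β : ℝ → ℝ → ℝ) : Prop where
  continuousOn : ContinuousOn (fun p : ℝ × ℝ => β p.1 p.2) (Ici 0 ×ˢ Ici 0)
  zero : ∀ τ, 0 ≤ τ → β 0 τ = 0
  strictMonoOn : ∀ τ, 0 ≤ τ → StrictMonoOn (fun ρ => β ρ τ) (Ici 0)
  antitoneOn : ∀ ρ, 0 ≤ ρ → AntitoneOn (β ρ) (Ici 0)
  tendsto : ∀ ρ, 0 ≤ ρ → Tendsto (β ρ) atTop (𝓝 0)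

/-- The radius of the ball that the tracking errors enter. -/
def radius (b c tf δ γ lamc lam0 V0 : ℝ) : ℝ :=
  2 * δ * Real.sqrt V0 * (δ / (tf + δ)) ^ (γ / 2) / (b * Real.sqrt (min lamc (c * lam0)))

end PrescribedTime

end

/-! For `μ = c₁⁻¹ - 1 > 0`, the bound on `P_c` makes the `η̂` part of `V` dissipate
`2 (1 + μ) r |η̂|²`. As `|P_c A_g| |θ_k - 1| ≤ 1`, the sensor error costs at most
`2 r |η̂| ((|P_c A_g| + 1) |ε| + |η̂|)`, and Young's inequality moves the mixed term into the
`ε` part of `V`, which is why `c` depends on `|P_c A_g|` and `μ` only. What remains is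
`V' ≤ -(r min(μ, 1) - (ṙ / r) C₂ - C₁) |(η̂, ε)|²`. Since `0 ≤ ṙ / r ≤ α₀`, `r = b α₀`, and `α₀` is
bounded below, a large `b` turns this into `V' ≤ -γ α₀ V`.

Integrating with `α₀ ≥ 1 / (t_f + δ)` gives the `𝒦ℒ` bound. Integrating `α₀` exactly over
`[0, t_f]` gives `V(t_f) ≤ V(0) (δ / (t_f + δ)) ^ γ`, and `r |e_k| ≤ |Λ_r e_k| = |η̂_k + ε_k|`,
valid because `r ≥ 1`, turns this into the bound on the tracking error. -/

namespace PrescribedTime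

open WithLp

section QuadraticForms

variable {ι κ : Type*} [Fintype ι] [Fintype κ]

theorem frobNorm_nonneg (M : Matrix ι κ ℝ) : 0 ≤ frobNorm M := Real.sqrt_nonneg _

theorem dotProduct_self_eq_norm_sq (x : ι → ℝ) : x ⬝ᵥ x = ‖toLp 2 x‖ ^ 2 := by
  rw [← real_inner_self_eq_norm_sq, EuclideanSpace.inner_toLp_toLp, star_trivial]

theorem dotProduct_le_norm_mul_norm (x y : ι → ℝ) : x ⬝ᵥ y ≤ ‖toLp 2 x‖ * ‖toLp 2 y‖ := by
  rw [mul_comm]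
  simpa only [EuclideanSpace.inner_toLp_toLp, star_trivial]
    using real_inner_le_norm (toLp 2 y) (toLp 2 x)

theorem norm_mulVec_le_frobNorm_mul (M : Matrix ι κ ℝ) (x : κ → ℝ) :
    ‖toLp 2 (M *ᵥ x)‖ ≤ frobNorm M * ‖toLp 2 x‖ := by
  rw [EuclideanSpace.norm_eq, EuclideanSpace.norm_eq, frobNorm, ← Real.sqrt_mul (by positivity),
    Finset.sum_mul]
  simp only [Real.norm_eq_abs, sq_abs]
  exact Real.sqrt_le_sqrt
    (Finset.sum_le_sum fun i _ => Finset.sum_mul_sq_le_sq_mul_sq _ (M i) x)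

theorem dotProduct_mulVec_le_frobNorm_mul (M : Matrix ι κ ℝ) (x : ι → ℝ) (y : κ → ℝ) :
    x ⬝ᵥ M *ᵥ y ≤ frobNorm M * ‖toLp 2 x‖ * ‖toLp 2 y‖ :=
  calc x ⬝ᵥ M *ᵥ y ≤ ‖toLp 2 x‖ * ‖toLp 2 (M *ᵥ y)‖ := dotProduct_le_norm_mul_norm _ _
    _ ≤ ‖toLp 2 x‖ * (frobNorm M * ‖toLp 2 y‖) := by gcongr; exact norm_mulVec_le_frobNorm_mul M y
    _ = frobNorm M * ‖toLp 2 x‖ * ‖toLp 2 y‖ := by ring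

theorem mul_norm_mul_le_norm {p : ℝ} {u : ι → ℝ} (hp : 0 ≤ p) (hu : ∀ i, p * |u i| ≤ 1)
    (x : ι → ℝ) : p * ‖toLp 2 (u * x)‖ ≤ ‖toLp 2 x‖ := by
  rw [← Real.norm_of_nonneg hp, ← norm_smul, EuclideanSpace.norm_eq, EuclideanSpace.norm_eq]
  gcongr with i
  simpa [abs_of_nonneg hp, mul_assoc] using mul_le_mul_of_nonneg_right (hu i) (abs_nonneg (x i))

theorem norm_le_card_mul_of_abs_le {a : ℝ} {x : ι → ℝ} (hx : ∀ i, |x i| ≤ a) :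
    ‖toLp 2 x‖ ≤ Fintype.card ι * a := by
  classical
  calc ‖toLp 2 x‖ = ‖∑ i, x i • EuclideanSpace.single i (1 : ℝ)‖ := by
        congr 1; ext j; simp [Pi.single_apply]
    _ ≤ ∑ i, ‖x i • EuclideanSpace.single i (1 : ℝ)‖ := norm_sum_le _ _
    _ ≤ ∑ _i : ι, a := by gcongr with i; simpa [norm_smul] using hx i
    _ = Fintype.card ι * a := by simp

theorem dotProduct_mulVec_comm_of_isHermitian {P : Matrix ι ι ℝ} (hP : P.IsHermitian)
    (x y : ι → ℝ) : x ⬝ᵥ P *ᵥ y = y ⬝ᵥ P *ᵥ x := by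
  rw [← dotProduct_transpose_mulVec, ← conjTranspose_eq_transpose_of_trivial, hP.eq]

theorem dotProduct_lyapunov_mulVec {P A : Matrix ι ι ℝ} (hP : P.IsHermitian) (x : ι → ℝ) :
    x ⬝ᵥ (P * A + Aᵀ * P) *ᵥ x = 2 * (x ⬝ᵥ (P * A) *ᵥ x) := by
  have hAP : Aᵀ * P = (P * A)ᵀ := by
    rw [transpose_mul, ← conjTranspose_eq_transpose_of_trivial P, hP.eq]
  rw [hAP, add_mulVec, dotProduct_add, dotProduct_transpose_mulVec, two_mul]

theorem hasDerivAt_dotProduct_mulVec_self {P : Matrix ι ι ℝ} (hP : P.IsHermitian)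
    {x : ℝ → ι → ℝ} {x' : ι → ℝ} {t : ℝ} (hx : HasDerivAt x x' t) :
    HasDerivAt (fun s => x s ⬝ᵥ P *ᵥ x s) (2 * (x t ⬝ᵥ P *ᵥ x')) t := by
  have hxi := hasDerivAt_pi.1 hx
  have h : HasDerivAt (fun s => x s ⬝ᵥ P *ᵥ x s) (x' ⬝ᵥ P *ᵥ x t + x t ⬝ᵥ P *ᵥ x') t := by
    simp only [dotProduct, ← Finset.sum_add_distrib]
    exact HasDerivAt.fun_sum fun i _ => (hxi i).mul
      (HasDerivAt.fun_sum fun j _ => (hxi j).const_mul (P i j))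
  rwa [dotProduct_mulVec_comm_of_isHermitian hP x', ← two_mul] at h

variable [DecidableEq ι]

theorem dotProduct_mulVec_le_of_posSemidef_neg_sub {Q : Matrix ι ι ℝ} {m : ℝ}
    (hQ : (-Q - m • 1).PosSemidef) (x : ι → ℝ) : x ⬝ᵥ Q *ᵥ x ≤ -m * ‖toLp 2 x‖ ^ 2 := by
  have h := hQ.dotProduct_mulVec_nonneg x
  rw [star_trivial, sub_mulVec, neg_mulVec, smul_mulVec, one_mulVec, dotProduct_sub,
    dotProduct_neg, dotProduct_smul, dotProduct_self_eq_norm_sq, smul_eq_mul] at h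
  linarith

theorem two_mul_dotProduct_mulVec_le_of_posSemidef {P A : Matrix ι ι ℝ} {a m : ℝ}
    (hP : P.IsHermitian) (ha : 0 < a) (hA : (-(a • (P * A + Aᵀ * P)) - m • 1).PosSemidef)
    (x : ι → ℝ) : 2 * (x ⬝ᵥ (P * A) *ᵥ x) ≤ -(m / a) * ‖toLp 2 x‖ ^ 2 := by
  have h := dotProduct_mulVec_le_of_posSemidef_neg_sub hA x
  rw [smul_mulVec, dotProduct_smul, dotProduct_lyapunov_mulVec hP, smul_eq_mul,
    ← le_div_iff₀' ha] at h
  exact h.trans_eq (by ring)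

theorem lambdaMin_pos [Nonempty ι] {M : Matrix ι ι ℝ} (hM : M.PosDef) :
    0 < lambdaMin hM.isHermitian := by
  obtain ⟨i, hi⟩ := exists_eq_ciInf_of_finite (f := hM.isHermitian.eigenvalues)
  exact (hM.eigenvalues_pos i).trans_eq hi

open scoped MatrixOrder in
theorem lambdaMin_mul_norm_sq_le {M : Matrix ι ι ℝ} (hM : M.IsHermitian) (x : ι → ℝ) :
    lambdaMin hM * ‖toLp 2 x‖ ^ 2 ≤ x ⬝ᵥ M *ᵥ x := by
  have hle : algebraMap ℝ (Matrix ι ι ℝ) (lambdaMin hM) ≤ M := by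
    rw [algebraMap_le_iff_le_spectrum hM, hM.spectrum_real_eq_range_eigenvalues]
    rintro _ ⟨i, rfl⟩
    exact ciInf_le (finite_range _).bddBelow i
  have h := (Matrix.le_iff.1 hle).dotProduct_mulVec_nonneg x
  rw [star_trivial, sub_mulVec, dotProduct_sub, Algebra.algebraMap_eq_smul_one, smul_mulVec,
    one_mulVec, dotProduct_smul, dotProduct_self_eq_norm_sq, smul_eq_mul] at h
  linarith

end QuadraticForms

section Comparison

theorem IsLocallyFinite.insert {E : Set ℝ} (hE : IsLocallyFinite E) (x : ℝ) :
    IsLocallyFinite (insert x E) := fun a b =>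
  ((hE a b).insert x).subset fun _ ⟨hyE, hy⟩ => hyE.imp id fun hyE => ⟨hyE, hy⟩

theorem le_of_hasDerivAt_nonpos_off_finite {f : ℝ → ℝ} {E : Set ℝ} (hE : E.Finite) {a b : ℝ}
    (hab : a ≤ b) (hf : ContinuousOn f (Icc a b))
    (hf' : ∀ t ∈ Ioo a b, t ∉ E → ∃ f', HasDerivAt f f' t ∧ f' ≤ 0) : f b ≤ f a := by
  induction E, hE using Set.Finite.induction_on generalizing a b with
  | empty =>
    have hd : ∀ t ∈ interior (Icc a b), ∃ f', HasDerivAt f f' t ∧ f' ≤ 0 := by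
      simpa only [interior_Icc, mem_empty_iff_false, not_false_eq_true, forall_const] using hf'
    refine antitoneOn_of_deriv_nonpos (convex_Icc a b) hf (fun t ht => ?_) (fun t ht => ?_)
      (left_mem_Icc.2 hab) (right_mem_Icc.2 hab) hab
    · obtain ⟨f', h, -⟩ := hd t ht
      exact h.differentiableAt.differentiableWithinAt
    · obtain ⟨f', h, h0⟩ := hd t ht
      rwa [h.deriv]
  | @insert x E _ _ ih =>
    by_cases hx : x ∈ Ioo a b
    · calc f b ≤ f x := ih hx.2.le (hf.mono (Icc_subset_Icc_left hx.1.le)) fun t ht htE =>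
            hf' t ⟨hx.1.trans ht.1, ht.2⟩ (mt (·.resolve_left ht.1.ne') htE)
        _ ≤ f a := ih hx.1.le (hf.mono (Icc_subset_Icc_right hx.2.le)) fun t ht htE =>
            hf' t ⟨ht.1, ht.2.trans hx.2⟩ (mt (·.resolve_left ht.2.ne) htE)
    · refine ih hab hf fun t ht htE => hf' t ht (mt (·.resolve_left ?_) htE)
      rintro rfl
      exact hx ht

/-- `V` satisfies the differential inequality `V' ≤ -w V` on `I`, for a continuous `V` that may
fail to be differentiable at a locally finite set of times. -/
structure DecaysOn (I : Set ℝ) (w V : ℝ → ℝ) : Prop where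
  continuousOn : ContinuousOn V I
  exists_hasDerivAt : ∃ E, IsLocallyFinite E ∧
    ∀ t ∈ I, t ∉ E → ∃ V', HasDerivAt V V' t ∧ V' ≤ -w t * V t

namespace DecaysOn

variable {I : Set ℝ} {w V : ℝ → ℝ} {a b : ℝ}

theorem mono_rate (hV : DecaysOn I w V) {u : ℝ → ℝ} (hu : ∀ t ∈ I, u t ≤ w t)
    (h0 : ∀ t ∈ I, 0 ≤ V t) : DecaysOn I u V := by
  obtain ⟨E, hE, hd⟩ := hV.exists_hasDerivAt
  refine ⟨hV.continuousOn, E, hE, fun t ht htE => ?_⟩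
  obtain ⟨V', hV', hle⟩ := hd t ht htE
  exact ⟨V', hV', hle.trans (mul_le_mul_of_nonneg_right (neg_le_neg (hu t ht)) (h0 t ht))⟩

theorem le_mul_exp (hV : DecaysOn I w V) (hI : Icc a b ⊆ I) (hab : a ≤ b) {W : ℝ → ℝ}
    (hW : ContinuousOn W (Icc a b)) (hW' : ∀ t ∈ Ioo a b, HasDerivAt W (w t) t) :
    V b ≤ V a * Real.exp (W a - W b) := by
  obtain ⟨E, hE, hd⟩ := hV.exists_hasDerivAt
  have hmono : V b * Real.exp (W b) ≤ V a * Real.exp (W a) := by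
    refine le_of_hasDerivAt_nonpos_off_finite (f := fun t => V t * Real.exp (W t)) (hE a b) hab
      ((hV.continuousOn.mono hI).mul hW.rexp) fun t ht htE => ?_
    have ht' := Ioo_subset_Icc_self ht
    obtain ⟨V', hV', hle⟩ := hd t (hI ht') fun h => htE ⟨h, ht'⟩
    refine ⟨_, hV'.mul (hW' t ht).exp, ?_⟩
    linarith [mul_le_mul_of_nonneg_right hle (Real.exp_pos (W t)).le]
  rwa [Real.exp_sub, ← mul_div_assoc, le_div_iff₀ (Real.exp_pos _)]

theorem le_mul_exp_of_const {κ : ℝ} (hV : DecaysOn I (fun _ => κ) V) (hI : Icc a b ⊆ I)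
    (hab : a ≤ b) : V b ≤ V a * Real.exp (-(κ * (b - a))) := by
  have h := hV.le_mul_exp hI hab (W := (κ * ·)) (by fun_prop)
    fun t _ => by simpa using (hasDerivAt_id t).const_mul κ
  rwa [show κ * a - κ * b = -(κ * (b - a)) by ring] at h

theorem le_of_nonneg_rate (hV : DecaysOn I w V) (hI : Icc a b ⊆ I) (hab : a ≤ b)
    (hw : ∀ t ∈ I, 0 ≤ w t) (h0 : ∀ t ∈ I, 0 ≤ V t) : V b ≤ V a := by
  simpa using (hV.mono_rate hw h0).le_mul_exp_of_const hI hab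

end DecaysOn

theorem isClassKL_mul_exp {M κ : ℝ} (hM : 0 < M) (hκ : 0 < κ) :
    IsClassKL fun ρ τ => M * ρ * Real.exp (-(κ * τ)) where
  continuousOn := by fun_prop
  zero := by simp
  strictMonoOn τ _ ρ _ σ _ hρσ := by
    have := Real.exp_pos (-(κ * τ))
    dsimp only
    gcongr
  antitoneOn ρ hρ τ _ σ _ hτσ := by
    dsimp only
    gcongr
  tendsto ρ _ := by
    have h : Tendsto (fun τ => Real.exp (-(κ * τ))) atTop (𝓝 0) :=
      Real.tendsto_exp_neg_atTop_nhds_zero.comp (tendsto_id.const_mul_atTop hκ)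
    simpa using h.const_mul (M * ρ)

end Comparison

section Dissipation

variable {ι : Type*} [Fintype ι]

theorem two_mul_dotProduct_mulVec_perturbed_le {P A D : Matrix ι ι ℝ} {x : ι → ℝ} {m r q : ℝ}
    (hA : 2 * (x ⬝ᵥ (P * A) *ᵥ x) ≤ -m * ‖toLp 2 x‖ ^ 2) (hr : 0 ≤ r) (hq : 0 ≤ q)
    (w : ι → ℝ) :
    2 * (x ⬝ᵥ P *ᵥ (r • (A *ᵥ x + w) + q • (D *ᵥ x))) ≤
      r * (-m * ‖toLp 2 x‖ ^ 2 + 2 * (x ⬝ᵥ P *ᵥ w))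
        + q * (2 * frobNorm (P * D) * ‖toLp 2 x‖ ^ 2) := by
  have hD : 2 * (x ⬝ᵥ (P * D) *ᵥ x) ≤ 2 * frobNorm (P * D) * ‖toLp 2 x‖ ^ 2 := by
    linarith [dotProduct_mulVec_le_frobNorm_mul (P * D) x x]
  calc 2 * (x ⬝ᵥ P *ᵥ (r • (A *ᵥ x + w) + q • (D *ᵥ x)))
      = r * (2 * (x ⬝ᵥ (P * A) *ᵥ x) + 2 * (x ⬝ᵥ P *ᵥ w)) + q * (2 * (x ⬝ᵥ (P * D) *ᵥ x)) := by
        simp only [mulVec_add, mulVec_smul, dotProduct_add, dotProduct_smul, mulVec_mulVec,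
          smul_eq_mul]
        ring
    _ ≤ _ := by gcongr

theorem mul_norm_sensor_error_le {p : ℝ} {θ : ι → ℝ} (hp : 0 ≤ p)
    (hθ : ∀ i, p * |θ i - 1| ≤ 1) (z h : ι → ℝ) :
    p * ‖toLp 2 (θ * z + (θ - 1) * h)‖ ≤ (p + 1) * ‖toLp 2 z‖ + ‖toLp 2 h‖ :=
  calc p * ‖toLp 2 (θ * z + (θ - 1) * h)‖ = p * ‖toLp 2 z + toLp 2 ((θ - 1) * (z + h))‖ := by
        rw [← toLp_add]; congr 3; ring
    _ ≤ p * ‖toLp 2 z‖ + p * ‖toLp 2 ((θ - 1) * (z + h))‖ := by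
        rw [← mul_add]; gcongr; exact norm_add_le _ _
    _ ≤ p * ‖toLp 2 z‖ + (‖toLp 2 z‖ + ‖toLp 2 h‖) := by
        gcongr
        exact (mul_norm_mul_le_norm hp hθ _).trans (norm_add_le (toLp 2 z) (toLp 2 h))
    _ = (p + 1) * ‖toLp 2 z‖ + ‖toLp 2 h‖ := by ring

/-- The weight `c` of the observer part of the Lyapunov function, for `p = |P_c A_g|` and
`μ = c₁⁻¹ - 1`: it absorbs the term `(p + 1)² / μ * |ε|²` that Young's inequality produces from the
coupling `2 (p + 1) |η̂| |ε|`. -/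
noncomputable def observerWeight (p μ : ℝ) : ℝ := μ⁻¹ * (p + 1) ^ 2 + 1

theorem observerWeight_pos {μ : ℝ} (p : ℝ) (hμ : 0 < μ) : 0 < observerWeight p μ := by
  rw [observerWeight]; positivity

theorem coupling_le_neg_min {μ : ℝ} (hμ : 0 < μ) (p h z : ℝ) :
    -(2 * (1 + μ)) * h ^ 2 + 2 * (h * ((p + 1) * z + h)) - observerWeight p μ * z ^ 2
      ≤ -(min μ 1 * (h ^ 2 + z ^ 2)) := by
  have young := two_mul_le_add_mul_sq (a := h) (b := (p + 1) * z) hμ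
  have hh := mul_le_mul_of_nonneg_right (min_le_left μ 1) (sq_nonneg h)
  have hz := mul_le_mul_of_nonneg_right (min_le_right μ 1) (sq_nonneg z)
  rw [observerWeight]
  linarith

theorem mul_dotProduct_mulVec_le_of_mul_norm_le (P : Matrix ι ι ℝ) {z w : ι → ℝ} {r R h : ℝ}
    (hr : 0 ≤ r) (hR : 0 ≤ R) (hw : r * ‖toLp 2 w‖ ≤ R * (h + ‖toLp 2 z‖)) :
    r * (z ⬝ᵥ P *ᵥ w) ≤ frobNorm P * R * (2 * (h ^ 2 + ‖toLp 2 z‖ ^ 2)) := by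
  have hP := frobNorm_nonneg P
  calc r * (z ⬝ᵥ P *ᵥ w) ≤ r * (frobNorm P * ‖toLp 2 z‖ * ‖toLp 2 w‖) := by
        gcongr; exact dotProduct_mulVec_le_frobNorm_mul P z w
    _ = frobNorm P * ‖toLp 2 z‖ * (r * ‖toLp 2 w‖) := by ring
    _ ≤ frobNorm P * ‖toLp 2 z‖ * (R * (h + ‖toLp 2 z‖)) := by gcongr
    _ = frobNorm P * R * (‖toLp 2 z‖ * (h + ‖toLp 2 z‖)) := by ring
    _ ≤ frobNorm P * R * (2 * (h ^ 2 + ‖toLp 2 z‖ ^ 2)) := by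
        refine mul_le_mul_of_nonneg_left ?_ (by positivity)
        nlinarith [sq_nonneg (h - ‖toLp 2 z‖)]

theorem stacked_dissipation {Pc P₀ Ac A₀ Ag D : Matrix ι ι ℝ} {H Z X Ψ : ι → ℝ} {μ c R r q : ℝ}
    (hAc : 2 * (H ⬝ᵥ (Pc * Ac) *ᵥ H) ≤ -(2 * (1 + μ)) * ‖toLp 2 H‖ ^ 2)
    (hA₀ : 2 * (Z ⬝ᵥ (P₀ * A₀) *ᵥ Z) ≤ -1 * ‖toLp 2 Z‖ ^ 2)
    (hμ : 0 < μ) (hc : c = observerWeight (frobNorm (Pc * Ag)) μ)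
    (hR : 0 ≤ R) (hr : 0 ≤ r) (hq : 0 ≤ q)
    (hX : frobNorm (Pc * Ag) * ‖toLp 2 X‖
      ≤ (frobNorm (Pc * Ag) + 1) * ‖toLp 2 Z‖ + ‖toLp 2 H‖)
    (hΨ : r * ‖toLp 2 Ψ‖ ≤ R * (‖toLp 2 H‖ + ‖toLp 2 Z‖)) :
    2 * (H ⬝ᵥ Pc *ᵥ (r • (Ac *ᵥ H + Ag *ᵥ X) + q • (D *ᵥ H)))
        + c * (2 * (Z ⬝ᵥ P₀ *ᵥ (r • (A₀ *ᵥ Z + Ψ) + q • (D *ᵥ Z))))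
      ≤ -(r * min μ 1 - q * (2 * frobNorm (Pc * D) + 2 * c * frobNorm (P₀ * D))
          - 4 * c * frobNorm P₀ * R) * (‖toLp 2 H‖ ^ 2 + ‖toLp 2 Z‖ ^ 2) := by
  have hc0 : 0 < c := hc ▸ observerWeight_pos _ hμ
  have hAX : H ⬝ᵥ Pc *ᵥ (Ag *ᵥ X)
      ≤ ‖toLp 2 H‖ * ((frobNorm (Pc * Ag) + 1) * ‖toLp 2 Z‖ + ‖toLp 2 H‖) := by
    rw [mulVec_mulVec]
    linarith [dotProduct_mulVec_le_frobNorm_mul (Pc * Ag) H X,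
      mul_le_mul_of_nonneg_left hX (norm_nonneg (toLp 2 H))]
  have hPΨ := mul_dotProduct_mulVec_le_of_mul_norm_le P₀ hr hR hΨ
  have hDc : 2 * frobNorm (Pc * D) * ‖toLp 2 H‖ ^ 2
      ≤ 2 * frobNorm (Pc * D) * (‖toLp 2 H‖ ^ 2 + ‖toLp 2 Z‖ ^ 2) := by
    have := frobNorm_nonneg (Pc * D)
    gcongr; exact le_add_of_nonneg_right (sq_nonneg _)
  have hD₀ : 2 * frobNorm (P₀ * D) * ‖toLp 2 Z‖ ^ 2
      ≤ 2 * frobNorm (P₀ * D) * (‖toLp 2 H‖ ^ 2 + ‖toLp 2 Z‖ ^ 2) := by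
    have := frobNorm_nonneg (P₀ * D)
    gcongr; exact le_add_of_nonneg_left (sq_nonneg _)
  have main := coupling_le_neg_min hμ (frobNorm (Pc * Ag)) ‖toLp 2 H‖ ‖toLp 2 Z‖
  rw [← hc] at main
  have hη := two_mul_dotProduct_mulVec_perturbed_le (D := D) hAc hr hq (Ag *ᵥ X)
  have hε := two_mul_dotProduct_mulVec_perturbed_le (D := D) hA₀ hr hq Ψ
  linarith [mul_le_mul_of_nonneg_left hε hc0.le, mul_le_mul_of_nonneg_left hPΨ hc0.le,
    mul_le_mul_of_nonneg_left hAX hr, mul_le_mul_of_nonneg_left main hr,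
    mul_le_mul_of_nonneg_left hDc hq,
    mul_le_mul_of_nonneg_left (mul_le_mul_of_nonneg_left hD₀ hq) hc0.le]

end Dissipation

section Gain

variable {b tf δ t : ℝ}

theorem alphaSat_eq (tf δ t : ℝ) : alphaSat tf δ t = 1 / (tf + δ - min t tf) := by
  rw [alphaSat]
  split_ifs with h
  · rw [min_eq_left h.le]
  · rw [min_eq_right (not_lt.1 h), add_sub_cancel_left]

theorem alphaSat_pos (hδ : 0 < δ) (t : ℝ) : 0 < alphaSat tf δ t := by
  rw [alphaSat_eq]
  exact one_div_pos.2 (by linarith [min_le_right t tf])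

theorem one_div_le_alphaSat (htf : 0 ≤ tf) (hδ : 0 < δ) (ht : 0 ≤ t) :
    1 / (tf + δ) ≤ alphaSat tf δ t := by
  rw [alphaSat_eq]
  exact one_div_le_one_div_of_le (by linarith [min_le_right t tf])
    (by linarith [le_min ht htf])

theorem one_le_gain (htf : 0 ≤ tf) (hδ : 0 < δ) (hb : tf + δ ≤ b) (ht : 0 ≤ t) :
    1 ≤ gain b tf δ t := by
  have hα := (div_le_iff₀ (by linarith)).1 (one_div_le_alphaSat htf hδ ht)
  rw [gain]
  linarith [mul_le_mul_of_nonneg_left hb (alphaSat_pos (tf := tf) hδ t).le]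

theorem gain_of_le (ht : tf ≤ t) : gain b tf δ t = b / δ := by
  rw [gain, alphaSat, if_neg ht.not_gt, mul_one_div]

theorem continuous_gain (hδ : 0 < δ) : Continuous (gain b tf δ) := by
  unfold gain
  simp only [alphaSat_eq]
  exact continuous_const.mul (continuous_const.div (by fun_prop) fun t =>
    ne_of_gt (by linarith [min_le_right t tf]))

theorem deriv_gain_div_of_lt (hδ : 0 < δ) (hb : b ≠ 0) (ht : t < tf) :
    deriv (gain b tf δ) t / gain b tf δ t = alphaSat tf δ t := by
  have hne : tf + δ - t ≠ 0 := by linarith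
  have h : HasDerivAt (fun u => b * (tf + δ - u)⁻¹) (b * (-(-1) / (tf + δ - t) ^ 2)) t :=
    (((hasDerivAt_id t).const_sub (tf + δ)).inv hne).const_mul b
  have heq : gain b tf δ =ᶠ[𝓝 t] fun u => b * (tf + δ - u)⁻¹ := by
    filter_upwards [eventually_lt_nhds ht] with u hu
    rw [gain, alphaSat, if_pos hu, one_div]
  rw [(h.congr_of_eventuallyEq heq).deriv, gain, alphaSat, if_pos ht]
  field_simp

theorem deriv_gain_of_gt (ht : tf < t) : deriv (gain b tf δ) t = 0 := by
  have heq : gain b tf δ =ᶠ[𝓝 t] fun _ => b / δ := by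
    filter_upwards [eventually_gt_nhds ht] with u hu using gain_of_le hu.le
  rw [heq.deriv_eq, deriv_const]

theorem deriv_gain_div_mem_Icc (hδ : 0 < δ) (hb : b ≠ 0) (ht : t ≠ tf) :
    deriv (gain b tf δ) t / gain b tf δ t ∈ Icc 0 (alphaSat tf δ t) := by
  have hα := (alphaSat_pos (tf := tf) hδ t).le
  rcases ht.lt_or_gt with h | h
  · rw [deriv_gain_div_of_lt hδ hb h]
    exact ⟨hα, le_rfl⟩
  · rw [deriv_gain_of_gt h, zero_div]
    exact ⟨le_rfl, hα⟩

theorem exists_gain_dominates (htf : 0 ≤ tf) (hδ : 0 < δ) {m C₁ C₂ : ℝ} (hm : 0 < m)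
    (hC₁ : 0 ≤ C₁) (hC₂ : 0 ≤ C₂) (C₃ : ℝ) :
    ∃ b, tf + δ ≤ b ∧ ∀ t, 0 ≤ t → ∀ q ∈ Icc 0 (alphaSat tf δ t),
      alphaSat tf δ t * C₃ ≤ gain b tf δ t * m - q * C₂ - C₁ := by
  refine ⟨max (tf + δ) ((C₂ + C₁ * (tf + δ) + C₃) / m), le_max_left _ _,
    fun t ht q hq => ?_⟩
  have hα := alphaSat_pos (tf := tf) hδ t
  have hb := (div_le_iff₀ hm).1 (le_max_right (tf + δ) ((C₂ + C₁ * (tf + δ) + C₃) / m))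
  have hαT := (div_le_iff₀ (by linarith)).1 (one_div_le_alphaSat htf hδ ht)
  rw [gain]
  linarith [mul_le_mul_of_nonneg_left hb hα.le, mul_le_mul_of_nonneg_right hq.2 hC₂,
    mul_le_mul_of_nonneg_left hαT hC₁]

theorem DecaysOn.apply_le_mul_rpow {V : ℝ → ℝ} {I : Set ℝ} {γ : ℝ} (htf : 0 ≤ tf) (hδ : 0 < δ)
    (hI : Icc 0 tf ⊆ I) (hV : DecaysOn I (fun t => γ * alphaSat tf δ t) V) :
    V tf ≤ V 0 * (δ / (tf + δ)) ^ γ := by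
  have hne : ∀ t ≤ tf, tf + δ - t ≠ 0 := fun t ht => by linarith
  have hW : ContinuousOn (fun t => -(γ * Real.log (tf + δ - t))) (Icc 0 tf) :=
    ((ContinuousOn.log (by fun_prop) fun t ht => hne t ht.2).const_mul γ).neg
  have h := hV.le_mul_exp hI htf hW fun t ht => by
    refine ((((hasDerivAt_id t).const_sub (tf + δ)).log
      (hne t ht.2.le)).const_mul γ).neg.congr_deriv ?_
    simp only [alphaSat, if_pos ht.2, id]
    ring
  have hT : 0 < tf + δ := by linarith
  rw [Real.rpow_def_of_pos (div_pos hδ hT), Real.log_div hδ.ne' hT.ne']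
  convert h using 3
  simp only [sub_zero, add_sub_cancel_left]
  ring

end Gain

section Stacking

variable {ι κ : Type*}

theorem hasDerivAt_uncurry {x : ι → ℝ → κ → ℝ} {x' : ι → κ → ℝ} {t : ℝ}
    (hx : ∀ k, HasDerivAt (x k) (x' k) t) :
    HasDerivAt (fun s => Function.uncurry fun k => x k s) (Function.uncurry x') t :=
  hasDerivAt_pi.2 fun p => hasDerivAt_pi.1 (hx p.1) p.2

variable [Fintype ι] [Fintype κ]

theorem kronecker_mulVec_uncurry (M : Matrix ι ι ℝ) (Q : Matrix κ κ ℝ) (x : ι → κ → ℝ) :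
    (M ⊗ₖ Q) *ᵥ Function.uncurry x = Function.uncurry fun k => ∑ j, M k j • Q *ᵥ x j := by
  ext ⟨k, i⟩
  simp [mulVec, dotProduct, Fintype.sum_prod_type, Finset.mul_sum, mul_assoc]

theorem one_kronecker_mulVec_uncurry [DecidableEq ι] (Q : Matrix κ κ ℝ) (x : ι → κ → ℝ) :
    ((1 : Matrix ι ι ℝ) ⊗ₖ Q) *ᵥ Function.uncurry x = Function.uncurry fun k => Q *ᵥ x k := by
  simp [kronecker_mulVec_uncurry, one_apply]

end Stacking

section ClosedLoop

variable {N n : ℕ}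

theorem leaderLaplacian_mulVec_apply (Gr : SimpleGraph (Fin N)) [DecidableRel Gr.Adj]
    (pin : Finset (Fin N)) (y : Fin N → ℝ) (k : Fin N) :
    (leaderLaplacian Gr pin *ᵥ y) k
      = (∑ j, Gr.adjMatrix ℝ k j * (y k - y j)) + (if k ∈ pin then (1 : ℝ) else 0) * y k := by
  have hdeg : ∑ j, Gr.adjMatrix ℝ k j = Gr.degree k := by
    simp [SimpleGraph.adjMatrix_apply, SimpleGraph.degree_eq_sum_if_adj]
  have hadj : ∑ j, Gr.adjMatrix ℝ k j * y j = ∑ j ∈ Gr.neighborFinset k, y j :=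
    Gr.adjMatrix_mulVec_apply k y
  rw [leaderLaplacian, add_mulVec, Pi.add_apply, SimpleGraph.lapMatrix_mulVec_apply,
    mulVec_diagonal]
  simp only [mul_sub, Finset.sum_sub_distrib, ← Finset.sum_mul, hdeg, hadj]

/-- The stacked vector `η̂`. -/
noncomputable def stackedEta (r : ℝ → ℝ) (s : Signals N n) (t : ℝ) : Fin N × Fin n → ℝ :=
  Function.uncurry fun k => etaHat r s k t

/-- The stacked vector `ε`. -/
noncomputable def stackedEps (r : ℝ → ℝ) (s : Signals N n) (t : ℝ) : Fin N × Fin n → ℝ :=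
  Function.uncurry fun k => epsErr r s k t

/-- The stacked vector `Φ`. -/
noncomputable def stackedPhi (F₀ : ℝ → (Fin n → ℝ) → Fin n → ℝ)
    (F : Fin N → ℝ → (Fin n → ℝ) → Fin n → ℝ) (r : ℝ → ℝ) (s : Signals N n) (t : ℝ) :
    Fin N × Fin n → ℝ :=
  Function.uncurry fun k => phi F₀ F r s k t

/-- The block diagonal matrix `I_N ⊗ D_c`. -/
noncomputable def stackedWeight (N n : ℕ) : Matrix (Fin N × Fin n) (Fin N × Fin n) ℝ :=
  (1 : Matrix (Fin N) (Fin N) ℝ) ⊗ₖ weightD n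

/-- The measurement error `θ ε₁ + (θ - 1) η̂₁` that enters the estimates through `A_g`, extended to
all coordinates. -/
noncomputable def sensorError (θ : Fin N → ℝ → ℝ) (r : ℝ → ℝ) (s : Signals N n) (t : ℝ) :
    Fin N × Fin n → ℝ :=
  (fun p => θ p.1 t) * stackedEps r s t + ((fun p => θ p.1 t) - 1) * stackedEta r s t

theorem control_eq (Gr : SimpleGraph (Fin N)) [DecidableRel Gr.Adj] (pin : Finset (Fin N))
    (K : Fin n → ℝ) (r : ℝ → ℝ) (s : Signals N n) (k : Fin N) (t : ℝ) :
    control Gr pin K r s k t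
      = -(leaderLaplacian Gr pin *ᵥ fun j => K ⬝ᵥ etaHat r s j t) k := by
  have hsub : ∀ j, scaling n (r t) *ᵥ (s.xhat k t - s.xhat j t)
      = etaHat r s k t - etaHat r s j t := fun j => by
    rw [etaHat, etaHat, ← mulVec_sub, sub_sub_sub_cancel_right]
  simp only [leaderLaplacian_mulVec_apply, control, mulVec_add, mulVec_sum, mulVec_smul, hsub,
    dotProduct_add, dotProduct_sum, dotProduct_smul, dotProduct_sub, smul_eq_mul]
  rfl

theorem closedA_mulVec_stackedEta (Gr : SimpleGraph (Fin N)) [DecidableRel Gr.Adj]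
    (pin : Finset (Fin N)) (K : Fin n → ℝ) (r : ℝ → ℝ) (s : Signals N n) (t : ℝ) :
    closedA Gr pin K *ᵥ stackedEta r s t = Function.uncurry fun k =>
      chainA n *ᵥ etaHat r s k t + control Gr pin K r s k t • inputB n := by
  rw [closedA, sub_mulVec, stackedEta, one_kronecker_mulVec_uncurry, kronecker_mulVec_uncurry]
  ext ⟨k, i⟩
  simp [control_eq, vecMulVec_mulVec, mulVec, dotProduct, Finset.sum_mul, mul_right_comm,
    sub_eq_add_neg, mul_assoc, mul_comm (inputB n i)]

theorem gainA_mulVec_uncurry [NeZero n] (G : Fin n → ℝ) (x : Fin N → Fin n → ℝ) :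
    gainA N G *ᵥ Function.uncurry x = Function.uncurry fun k => x k 0 • G := by
  simp [gainA, one_kronecker_mulVec_uncurry, vecMulVec_mulVec, outputC, single_dotProduct]

theorem IsClosedLoop.exists_hasDerivAt_stacked [NeZero n] {Gr : SimpleGraph (Fin N)}
    [DecidableRel Gr.Adj] {pin : Finset (Fin N)} {K G : Fin n → ℝ}
    {F₀ : ℝ → (Fin n → ℝ) → Fin n → ℝ} {F : Fin N → ℝ → (Fin n → ℝ) → Fin n → ℝ}
    {θ : Fin N → ℝ → ℝ} {r : ℝ → ℝ} {t₀ : ℝ} {S : EReal} {s : Signals N n}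
    (h : IsClosedLoop Gr pin K G F₀ F θ r t₀ S s) :
    ∃ E, IsLocallyFinite E ∧ ∀ t, t₀ < t → (t : EReal) < S → t ∉ E →
      HasDerivAt (stackedEta r s)
        (r t • (closedA Gr pin K *ᵥ stackedEta r s t + gainA N G *ᵥ sensorError θ r s t)
          + (deriv r t / r t) • (stackedWeight N n *ᵥ stackedEta r s t)) t ∧
      HasDerivAt (stackedEps r s)
        (r t • (observerA N G *ᵥ stackedEps r s t + stackedPhi F₀ F r s t)
          + (deriv r t / r t) • (stackedWeight N n *ᵥ stackedEps r s t)) t := by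
  obtain ⟨-, E, hE, hd⟩ := h
  refine ⟨E, hE, fun t ht htS htE => ⟨?_, ?_⟩⟩
  · have hsensor : sensorError θ r s t = Function.uncurry fun k =>
        θ k t • epsErr r s k t + (θ k t - 1) • etaHat r s k t := rfl
    refine (hasDerivAt_uncurry fun k => (hd t ht htS htE k).1).congr_deriv ?_
    rw [closedA_mulVec_stackedEta, hsensor, gainA_mulVec_uncurry, stackedWeight, stackedEta,
      one_kronecker_mulVec_uncurry]
    ext p
    simp only [Function.uncurry, Pi.add_apply, Pi.smul_apply, smul_eq_mul]
    ring
  · refine (hasDerivAt_uncurry fun k => (hd t ht htS htE k).2).congr_deriv ?_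
    rw [observerA, stackedWeight, stackedEps, one_kronecker_mulVec_uncurry,
      one_kronecker_mulVec_uncurry]
    rfl

end ClosedLoop

section Growth

variable {N n : ℕ} {ϱ : Fin N → Fin n → ℝ} {F₀ : ℝ → (Fin n → ℝ) → Fin n → ℝ}
  {F : Fin N → ℝ → (Fin n → ℝ) → Fin n → ℝ} {r : ℝ → ℝ} {s : Signals N n} {t : ℝ}

theorem etaHat_add_epsErr_apply (r : ℝ → ℝ) (s : Signals N n) (k : Fin N) (t : ℝ) (i : Fin n) :
    etaHat r s k t i + epsErr r s k t i = r t ^ (n - (i : ℕ)) * (s.x k t i - s.x₀ t i) := by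
  rw [epsErr, Pi.sub_apply, add_sub_cancel, scaling, mulVec_diagonal, Pi.sub_apply]

-- The triangular growth bound only involves `j ≤ i`, for which `r ^ (n - i) ≤ r ^ (n - j)`.
theorem pow_mul_sum_growth_le (hr : 1 ≤ r t) (k : Fin N) (i : Fin n) :
    r t ^ (n - (i : ℕ)) * ∑ j ∈ Finset.Iic i, ϱ k j * |s.x k t j - s.x₀ t j|
      ≤ ∑ j, |ϱ k j| * |etaHat r s k t j + epsErr r s k t j| := by
  have hr0 : 0 < r t := one_pos.trans_le hr
  calc r t ^ (n - (i : ℕ)) * ∑ j ∈ Finset.Iic i, ϱ k j * |s.x k t j - s.x₀ t j|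
      = ∑ j ∈ Finset.Iic i, ϱ k j * (r t ^ (n - (i : ℕ)) * |s.x k t j - s.x₀ t j|) := by
        rw [Finset.mul_sum]
        exact Finset.sum_congr rfl fun j _ => mul_left_comm _ _ _
    _ ≤ ∑ j ∈ Finset.Iic i, |ϱ k j| * (r t ^ (n - (j : ℕ)) * |s.x k t j - s.x₀ t j|) := by
        gcongr with j hj
        · exact le_abs_self _
        · exact Fin.le_def.1 (Finset.mem_Iic.1 hj)
    _ ≤ ∑ j, |ϱ k j| * (r t ^ (n - (j : ℕ)) * |s.x k t j - s.x₀ t j|) :=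
        Finset.sum_le_sum_of_subset_of_nonneg (Finset.subset_univ _) fun _ _ _ => by positivity
    _ = ∑ j, |ϱ k j| * |etaHat r s k t j + epsErr r s k t j| := by
        simp only [etaHat_add_epsErr_apply, abs_mul, abs_of_pos (pow_pos hr0 _)]

theorem abs_gain_mul_phi_le (hF : GrowthBound ϱ F₀ F s.x₀) (ht : 0 ≤ t) (hr : 1 ≤ r t)
    (k : Fin N) (i : Fin n) :
    |r t * phi F₀ F r s k t i| ≤ ∑ j, |ϱ k j| * |etaHat r s k t j + epsErr r s k t j| := by
  have hr0 : 0 < r t := one_pos.trans_le hr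
  have hpow : r t * r t ^ (n - 1 - (i : ℕ)) = r t ^ (n - (i : ℕ)) := by
    rw [← pow_succ']
    congr 1
    omega
  calc |r t * phi F₀ F r s k t i|
      = r t ^ (n - (i : ℕ)) * |F k t (s.x k t) i - F₀ t (s.x₀ t) i| := by
        rw [phi, ← mul_assoc, hpow, abs_mul, abs_of_pos (pow_pos hr0 _)]
    _ ≤ r t ^ (n - (i : ℕ)) * ∑ j ∈ Finset.Iic i, ϱ k j * |s.x k t j - s.x₀ t j| := by
        gcongr
        exact hF t ht k _ i
    _ ≤ _ := pow_mul_sum_growth_le hr k i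

/-- A Lipschitz-type constant of the stacked nonlinearity: `r |Φ| ≤ growthConst ϱ * (|η̂| + |ε|)`
whenever `r ≥ 1`. -/
noncomputable def growthConst (ϱ : Fin N → Fin n → ℝ) : ℝ :=
  Fintype.card (Fin N × Fin n) * ∑ k, ∑ j, |ϱ k j|

theorem growthConst_nonneg (ϱ : Fin N → Fin n → ℝ) : 0 ≤ growthConst ϱ := by
  rw [growthConst]; positivity

theorem gain_mul_norm_stackedPhi_le (hF : GrowthBound ϱ F₀ F s.x₀) (ht : 0 ≤ t)
    (hr : 1 ≤ r t) :
    r t * ‖toLp 2 (stackedPhi F₀ F r s t)‖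
      ≤ growthConst ϱ * (‖toLp 2 (stackedEta r s t)‖ + ‖toLp 2 (stackedEps r s t)‖) := by
  have hstate : ∀ k j, |etaHat r s k t j + epsErr r s k t j|
      ≤ ‖toLp 2 (stackedEta r s t)‖ + ‖toLp 2 (stackedEps r s t)‖ := fun k j =>
    (abs_add_le _ _).trans (add_le_add
      (PiLp.norm_apply_le (toLp 2 (stackedEta r s t)) (k, j))
      (PiLp.norm_apply_le (toLp 2 (stackedEps r s t)) (k, j)))
  rw [← Real.norm_of_nonneg (zero_le_one.trans hr), ← norm_smul, growthConst, mul_assoc]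
  refine norm_le_card_mul_of_abs_le (x := r t • stackedPhi F₀ F r s t) fun ⟨k, i⟩ => ?_
  calc |r t * phi F₀ F r s k t i|
      ≤ ∑ j, |ϱ k j| * |etaHat r s k t j + epsErr r s k t j| := abs_gain_mul_phi_le hF ht hr k i
    _ ≤ ∑ j, |ϱ k j| * (‖toLp 2 (stackedEta r s t)‖ + ‖toLp 2 (stackedEps r s t)‖) := by
        gcongr with j
        exact hstate k j
    _ = (∑ j, |ϱ k j|) * (‖toLp 2 (stackedEta r s t)‖ + ‖toLp 2 (stackedEps r s t)‖) :=
        (Finset.sum_mul ..).symm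
    _ ≤ (∑ k, ∑ j, |ϱ k j|) * (‖toLp 2 (stackedEta r s t)‖ + ‖toLp 2 (stackedEps r s t)‖) := by
        gcongr
        exact Finset.single_le_sum (f := fun k => ∑ j, |ϱ k j|)
          (fun _ _ => by positivity) (Finset.mem_univ k)

end Growth

section Lyapunov

variable {N n : ℕ} {Pc P₀ : Matrix (Fin N × Fin n) (Fin N × Fin n) ℝ} {c : ℝ} {r : ℝ → ℝ}
  {s : Signals N n} {t : ℝ}

theorem stateNorm_nonneg (r : ℝ → ℝ) (s : Signals N n) (t : ℝ) : 0 ≤ stateNorm r s t :=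
  Real.sqrt_nonneg _

theorem stateNorm_sq (r : ℝ → ℝ) (s : Signals N n) (t : ℝ) :
    stateNorm r s t ^ 2 = ‖toLp 2 (stackedEta r s t)‖ ^ 2 + ‖toLp 2 (stackedEps r s t)‖ ^ 2 := by
  rw [stateNorm, Real.sq_sqrt (by positivity), EuclideanSpace.real_norm_sq_eq,
    EuclideanSpace.real_norm_sq_eq, ← Finset.sum_add_distrib, Fintype.sum_prod_type]
  rfl

theorem lyapV_eq (Pc P₀ : Matrix (Fin N × Fin n) (Fin N × Fin n) ℝ) (c : ℝ) (r : ℝ → ℝ)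
    (s : Signals N n) (t : ℝ) :
    lyapV Pc P₀ c r s t = stackedEta r s t ⬝ᵥ Pc *ᵥ stackedEta r s t
      + c * (stackedEps r s t ⬝ᵥ P₀ *ᵥ stackedEps r s t) := rfl

theorem lyapV_le_mul_stateNorm_sq (hc : 0 ≤ c) :
    lyapV Pc P₀ c r s t ≤ (frobNorm Pc + c * frobNorm P₀) * stateNorm r s t ^ 2 := by
  have hη := dotProduct_mulVec_le_frobNorm_mul Pc (stackedEta r s t) (stackedEta r s t)
  have hε := mul_le_mul_of_nonneg_left
    (dotProduct_mulVec_le_frobNorm_mul P₀ (stackedEps r s t) (stackedEps r s t)) hc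
  have hPc := mul_nonneg (frobNorm_nonneg Pc) (sq_nonneg ‖toLp 2 (stackedEps r s t)‖)
  have hP₀ := mul_nonneg (mul_nonneg hc (frobNorm_nonneg P₀))
    (sq_nonneg ‖toLp 2 (stackedEta r s t)‖)
  rw [lyapV_eq, stateNorm_sq]
  linarith

theorem min_lambdaMin_mul_stateNorm_sq_le (hPc : Pc.IsHermitian) (hP₀ : P₀.IsHermitian)
    (hc : 0 ≤ c) :
    min (lambdaMin hPc) (c * lambdaMin hP₀) * stateNorm r s t ^ 2 ≤ lyapV Pc P₀ c r s t := by
  have hε := mul_le_mul_of_nonneg_left (lambdaMin_mul_norm_sq_le hP₀ (stackedEps r s t)) hc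
  rw [← mul_assoc] at hε
  rw [lyapV_eq, stateNorm_sq, mul_add]
  exact add_le_add
    ((mul_le_mul_of_nonneg_right (min_le_left _ _) (sq_nonneg _)).trans
      (lambdaMin_mul_norm_sq_le hPc _))
    ((mul_le_mul_of_nonneg_right (min_le_right _ _) (sq_nonneg _)).trans hε)

theorem lyapV_nonneg (hPc : Pc.PosSemidef) (hP₀ : P₀.PosSemidef) (hc : 0 ≤ c) :
    0 ≤ lyapV Pc P₀ c r s t :=
  add_nonneg (hPc.dotProduct_mulVec_nonneg _) (mul_nonneg hc (hP₀.dotProduct_mulVec_nonneg _))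

theorem continuousOn_lyapV {I : Set ℝ}
    (h : ∀ k, ContinuousOn (etaHat r s k) I ∧ ContinuousOn (epsErr r s k) I) :
    ContinuousOn (lyapV Pc P₀ c r s) I := by
  have hη : ∀ p : Fin N × Fin n, ContinuousOn (fun t => etaHat r s p.1 t p.2) I :=
    fun p => continuousOn_pi.1 (h p.1).1 p.2
  have hε : ∀ p : Fin N × Fin n, ContinuousOn (fun t => epsErr r s p.1 t p.2) I :=
    fun p => continuousOn_pi.1 (h p.1).2 p.2
  unfold lyapV
  simp only [dotProduct, mulVec]
  fun_prop

theorem IsClosedLoop.exists_hasDerivAt_lyapV_le [NeZero n] {Gr : SimpleGraph (Fin N)}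
    [DecidableRel Gr.Adj] {pin : Finset (Fin N)} {K G : Fin n → ℝ}
    {F₀ : ℝ → (Fin n → ℝ) → Fin n → ℝ} {F : Fin N → ℝ → (Fin n → ℝ) → Fin n → ℝ}
    {θ : Fin N → ℝ → ℝ} {ϱ : Fin N → Fin n → ℝ} {t₀ μ : ℝ} {S : EReal}
    (h : IsClosedLoop Gr pin K G F₀ F θ r t₀ S s)
    (hPc : Pc.IsHermitian) (hP₀ : P₀.IsHermitian) (hμ : 0 < μ)
    (hAc : ∀ x, 2 * (x ⬝ᵥ (Pc * closedA Gr pin K) *ᵥ x) ≤ -(2 * (1 + μ)) * ‖toLp 2 x‖ ^ 2)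
    (hA₀ : ∀ x, 2 * (x ⬝ᵥ (P₀ * observerA N G) *ᵥ x) ≤ -1 * ‖toLp 2 x‖ ^ 2)
    (hc : c = observerWeight (frobNorm (Pc * gainA N G)) μ)
    (hF : GrowthBound ϱ F₀ F s.x₀)
    (hθ : ∀ k t, 0 ≤ t → frobNorm (Pc * gainA N G) * |θ k t - 1| ≤ 1) (ht₀ : 0 ≤ t₀) :
    ∃ E, IsLocallyFinite E ∧ ∀ t, t₀ < t → (t : EReal) < S → t ∉ E → 1 ≤ r t →
      0 ≤ deriv r t / r t → ∃ V', HasDerivAt (lyapV Pc P₀ c r s) V' t ∧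
        V' ≤ -(r t * min μ 1 - deriv r t / r t * (2 * frobNorm (Pc * stackedWeight N n)
            + 2 * c * frobNorm (P₀ * stackedWeight N n))
          - 4 * c * frobNorm P₀ * growthConst ϱ) * stateNorm r s t ^ 2 := by
  obtain ⟨E, hE, hd⟩ := h.exists_hasDerivAt_stacked
  refine ⟨E, hE, fun t ht htS htE hr hq => ?_⟩
  have ht0 : 0 ≤ t := ht₀.trans ht.le
  obtain ⟨hη, hε⟩ := hd t ht htS htE
  have hp : ∀ p : Fin N × Fin n, frobNorm (Pc * gainA N G) * |θ p.1 t - 1| ≤ 1 :=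
    fun p => hθ p.1 t ht0
  have hX : frobNorm (Pc * gainA N G) * ‖toLp 2 (sensorError θ r s t)‖
      ≤ (frobNorm (Pc * gainA N G) + 1) * ‖toLp 2 (stackedEps r s t)‖
        + ‖toLp 2 (stackedEta r s t)‖ :=
    mul_norm_sensor_error_le (frobNorm_nonneg (Pc * gainA N G)) hp _ _
  have hdiss := stacked_dissipation (D := stackedWeight N n) (hAc (stackedEta r s t))
    (hA₀ (stackedEps r s t)) hμ hc (growthConst_nonneg ϱ) (zero_le_one.trans hr) hq hX
    (gain_mul_norm_stackedPhi_le hF ht0 hr)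
  rw [← stateNorm_sq] at hdiss
  have hV : HasDerivAt (lyapV Pc P₀ c r s) _ t :=
    (hasDerivAt_dotProduct_mulVec_self hPc hη).add
      ((hasDerivAt_dotProduct_mulVec_self hP₀ hε).const_mul c)
  exact ⟨_, hV, hdiss⟩

theorem exists_gain_decaysOn_lyapV [NeZero n] {Gr : SimpleGraph (Fin N)}
    [DecidableRel Gr.Adj] {pin : Finset (Fin N)} {K G : Fin n → ℝ} {c₁ tf δ γ : ℝ}
    (hc₁ : 0 < c₁ ∧ c₁ < 1) (hPc : Pc.IsHermitian) (hP₀ : P₀.IsHermitian)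
    (hPcA : (-(c₁ • (Pc * closedA Gr pin K + (closedA Gr pin K)ᵀ * Pc))
      - (2 : ℝ) • 1).PosSemidef)
    (hP₀A : (-(P₀ * observerA N G + (observerA N G)ᵀ * P₀) - 1).PosSemidef)
    (hc : c = observerWeight (frobNorm (Pc * gainA N G)) (c₁⁻¹ - 1)) (ϱ : Fin N → Fin n → ℝ)
    (htf : 0 ≤ tf) (hδ : 0 < δ) (hγ : 0 ≤ γ) :
    ∃ b, tf + δ ≤ b ∧ ∀ (F₀ : ℝ → (Fin n → ℝ) → Fin n → ℝ)
      (F : Fin N → ℝ → (Fin n → ℝ) → Fin n → ℝ) (θ : Fin N → ℝ → ℝ) (s : Signals N n)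
      (t₀ : ℝ) (S : EReal), GrowthBound ϱ F₀ F s.x₀ →
      (∀ k t, 0 ≤ t → frobNorm (Pc * gainA N G) * |θ k t - 1| ≤ 1) → 0 ≤ t₀ →
      IsClosedLoop Gr pin K G F₀ F θ (gain b tf δ) t₀ S s →
      DecaysOn {t | t₀ ≤ t ∧ (t : EReal) < S} (fun t => γ * alphaSat tf δ t)
        (lyapV Pc P₀ c (gain b tf δ) s) := by
  have hμ : 0 < c₁⁻¹ - 1 := sub_pos.2 ((one_lt_inv₀ hc₁.1).2 hc₁.2)
  have hAc : ∀ x, 2 * (x ⬝ᵥ (Pc * closedA Gr pin K) *ᵥ x)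
      ≤ -(2 * (1 + (c₁⁻¹ - 1))) * ‖toLp 2 x‖ ^ 2 := by
    rw [add_sub_cancel, ← div_eq_mul_inv]
    exact two_mul_dotProduct_mulVec_le_of_posSemidef hPc hc₁.1 hPcA
  have hA₀ : ∀ x, 2 * (x ⬝ᵥ (P₀ * observerA N G) *ᵥ x) ≤ -1 * ‖toLp 2 x‖ ^ 2 := by
    rw [← div_one (1 : ℝ)]
    exact two_mul_dotProduct_mulVec_le_of_posSemidef hP₀ one_pos (by rwa [one_smul, one_smul])
  have hc0 : 0 < c := hc ▸ observerWeight_pos _ hμ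
  have hPcD := frobNorm_nonneg (Pc * stackedWeight N n)
  have hP₀D := frobNorm_nonneg (P₀ * stackedWeight N n)
  have hP₀0 := frobNorm_nonneg P₀
  have hϱ := growthConst_nonneg ϱ
  obtain ⟨b, hb, hdom⟩ := exists_gain_dominates htf hδ (lt_min hμ one_pos)
    (C₁ := 4 * c * frobNorm P₀ * growthConst ϱ)
    (C₂ := 2 * frobNorm (Pc * stackedWeight N n) + 2 * c * frobNorm (P₀ * stackedWeight N n))
    (by positivity) (by positivity) (γ * (frobNorm Pc + c * frobNorm P₀))
  refine ⟨b, hb, fun F₀ F θ s t₀ S hF hθ ht₀ hcl => ⟨continuousOn_lyapV hcl.1, ?_⟩⟩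
  obtain ⟨E, hE, hd⟩ := hcl.exists_hasDerivAt_lyapV_le hPc hP₀ hμ hAc hA₀ hc hF hθ ht₀
  refine ⟨insert t₀ (insert tf E), (hE.insert tf).insert t₀, fun t ⟨ht, htS⟩ htE => ?_⟩
  simp only [mem_insert_iff, not_or] at htE
  have ht0 : 0 ≤ t := ht₀.trans ht
  have hq := deriv_gain_div_mem_Icc hδ (b := b) (by linarith) htE.2.1
  obtain ⟨V', hV', hle⟩ := hd t (ht.lt_of_ne' htE.1) htS htE.2.2 (one_le_gain htf hδ hb ht0) hq.1
  refine ⟨V', hV', hle.trans ?_⟩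
  have hα := mul_nonneg hγ (alphaSat_pos (tf := tf) hδ t).le
  have hV := mul_le_mul_of_nonneg_left
    (lyapV_le_mul_stateNorm_sq (Pc := Pc) (P₀ := P₀) (r := gain b tf δ) (s := s) (t := t) hc0.le) hα
  linarith [mul_le_mul_of_nonneg_right (hdom t ht0 _ hq) (sq_nonneg (stateNorm (gain b tf δ) s t))]

end Lyapunov

section Tracking

variable {N n : ℕ} {r : ℝ → ℝ} {s : Signals N n} {t : ℝ} {k : Fin N}

theorem norm_le_norm_uncurry {ι κ : Type*} [Fintype ι] [Fintype κ] (x : ι → κ → ℝ) (k : ι) :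
    ‖toLp 2 (x k)‖ ≤ ‖toLp 2 (Function.uncurry x)‖ := by
  rw [EuclideanSpace.norm_eq, EuclideanSpace.norm_eq, Fintype.sum_prod_type]
  exact Real.sqrt_le_sqrt (Finset.single_le_sum (f := fun k => ∑ i, ‖x k i‖ ^ 2)
    (fun _ _ => by positivity) (Finset.mem_univ k))

theorem mul_norm_le_norm_scaling_mulVec {ρ : ℝ} (hρ : 1 ≤ ρ) (v : Fin n → ℝ) :
    ρ * ‖toLp 2 v‖ ≤ ‖toLp 2 (scaling n ρ *ᵥ v)‖ := by
  have hρ0 := zero_le_one.trans hρ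
  rw [← Real.norm_of_nonneg hρ0, ← norm_smul, EuclideanSpace.norm_eq, EuclideanSpace.norm_eq]
  gcongr with i
  simp only [Real.norm_of_nonneg hρ0, scaling, mulVec_diagonal, ← toLp_smul, Pi.smul_apply,
    smul_eq_mul, norm_mul, norm_pow]
  gcongr
  exact le_self_pow₀ hρ (Nat.sub_ne_zero_of_lt i.2)

theorem norm_trackingError_le (hr : 1 ≤ r t) :
    ‖trackingError s k t‖ ≤ 2 * stateNorm r s t / r t := by
  have hη : ‖toLp 2 (stackedEta r s t)‖ ≤ stateNorm r s t :=
    le_of_sq_le_sq (by rw [stateNorm_sq]; linarith [sq_nonneg ‖toLp 2 (stackedEps r s t)‖])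
      (stateNorm_nonneg r s t)
  have hε : ‖toLp 2 (stackedEps r s t)‖ ≤ stateNorm r s t :=
    le_of_sq_le_sq (by rw [stateNorm_sq]; linarith [sq_nonneg ‖toLp 2 (stackedEta r s t)‖])
      (stateNorm_nonneg r s t)
  rw [le_div_iff₀' (one_pos.trans_le hr)]
  calc r t * ‖trackingError s k t‖ ≤ ‖toLp 2 (scaling n (r t) *ᵥ (s.x k t - s.x₀ t))‖ :=
        mul_norm_le_norm_scaling_mulVec hr _
    _ = ‖toLp 2 (etaHat r s k t) + toLp 2 (epsErr r s k t)‖ := by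
        rw [← toLp_add, epsErr, add_sub_cancel]
    _ ≤ ‖toLp 2 (stackedEta r s t)‖ + ‖toLp 2 (stackedEps r s t)‖ :=
        (norm_add_le _ _).trans (add_le_add
          (norm_le_norm_uncurry (fun k => etaHat r s k t) k)
          (norm_le_norm_uncurry (fun k => epsErr r s k t) k))
    _ ≤ 2 * stateNorm r s t := by linarith

theorem continuousOn_trackingError {I : Set ℝ} (hr : ContinuousOn r I) (hr0 : ∀ t ∈ I, r t ≠ 0)
    (h : ContinuousOn (etaHat r s k) I ∧ ContinuousOn (epsErr r s k) I) :
    ContinuousOn (trackingError s k) I := by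
  refine (PiLp.continuous_toLp 2 _).comp_continuousOn (continuousOn_pi.2 fun i => ?_)
  refine (((continuousOn_pi.1 h.1 i).add (continuousOn_pi.1 h.2 i)).div (hr.pow (n - i))
    fun t ht => pow_ne_zero _ (hr0 t ht)).congr fun t ht => ?_
  rw [Pi.div_apply, Pi.add_apply, Pi.pow_apply, etaHat_add_epsErr_apply,
    mul_div_cancel_left₀ _ (pow_ne_zero _ (hr0 t ht)), Pi.sub_apply]

end Tracking

section Estimates

variable {N n : ℕ} {Pc P₀ : Matrix (Fin N × Fin n) (Fin N × Fin n) ℝ} {c : ℝ} {r : ℝ → ℝ}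
  {s : Signals N n} {t₀ t b tf δ γ : ℝ} {S : EReal}

theorem Icc_subset_horizon (hS : (t : EReal) < S) :
    Icc t₀ t ⊆ {u | t₀ ≤ u ∧ (u : EReal) < S} := fun _ hu =>
  ⟨hu.1, (EReal.coe_le_coe_iff.2 hu.2).trans_lt hS⟩

theorem DecaysOn.lyapV_le_mul_rpow (hPc : Pc.PosSemidef) (hP₀ : P₀.PosSemidef) (hc : 0 ≤ c)
    (htf : 0 ≤ tf) (hδ : 0 < δ) (hγ : 0 ≤ γ)
    (hV : DecaysOn {u | 0 ≤ u ∧ (u : EReal) < S} (fun u => γ * alphaSat tf δ u)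
      (lyapV Pc P₀ c r s)) (ht : tf ≤ t) (htS : (t : EReal) < S) :
    lyapV Pc P₀ c r s t ≤ lyapV Pc P₀ c r s 0 * (δ / (tf + δ)) ^ γ :=
  have hI : Icc 0 t ⊆ {u : ℝ | 0 ≤ u ∧ (u : EReal) < S} := Icc_subset_horizon htS
  calc lyapV Pc P₀ c r s t ≤ lyapV Pc P₀ c r s tf :=
        hV.le_of_nonneg_rate ((Icc_subset_Icc_left htf).trans hI) ht
          (fun u _ => mul_nonneg hγ (alphaSat_pos hδ u).le) fun _ _ => lyapV_nonneg hPc hP₀ hc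
    _ ≤ _ := hV.apply_le_mul_rpow htf hδ ((Icc_subset_Icc_right ht).trans hI)

theorem frobNorm_pos {ι : Type*} [Fintype ι] [Nonempty ι] {M : Matrix ι ι ℝ} (hM : M.PosDef) :
    0 < frobNorm M := by
  have h := hM.dotProduct_mulVec_pos (x := 1) one_ne_zero
  rw [star_trivial] at h
  have h' := h.trans_le (dotProduct_mulVec_le_frobNorm_mul M 1 1)
  rw [mul_assoc] at h'
  exact pos_of_mul_pos_left h' (by positivity)

variable [Nonempty (Fin N × Fin n)]

theorem min_lambdaMin_pos (hPc : Pc.PosDef) (hP₀ : P₀.PosDef) (hc : 0 < c) :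
    0 < min (lambdaMin hPc.isHermitian) (c * lambdaMin hP₀.isHermitian) :=
  lt_min (lambdaMin_pos hPc) (mul_pos hc (lambdaMin_pos hP₀))

theorem stateNorm_le_sqrt_lyapV_div (hPc : Pc.PosDef) (hP₀ : P₀.PosDef) (hc : 0 < c) :
    stateNorm r s t ≤ √(lyapV Pc P₀ c r s t /
      min (lambdaMin hPc.isHermitian) (c * lambdaMin hP₀.isHermitian)) := by
  refine Real.le_sqrt_of_sq_le ?_
  rw [le_div_iff₀' (min_lambdaMin_pos hPc hP₀ hc)]
  exact min_lambdaMin_mul_stateNorm_sq_le _ _ hc.le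

/-- The overshoot `√(λ_max / λ_min)` of the exponential estimate, with the Frobenius norms of `P_c`
and `P₀` in place of their largest eigenvalues. -/
noncomputable def overshoot (hPc : Pc.PosDef) (hP₀ : P₀.PosDef) (c : ℝ) : ℝ :=
  √((frobNorm Pc + c * frobNorm P₀) /
    min (lambdaMin hPc.isHermitian) (c * lambdaMin hP₀.isHermitian))

theorem overshoot_pos (hPc : Pc.PosDef) (hP₀ : P₀.PosDef) (hc : 0 < c) :
    0 < overshoot hPc hP₀ c :=
  Real.sqrt_pos.2 (div_pos (add_pos (frobNorm_pos hPc) (mul_pos hc (frobNorm_pos hP₀)))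
    (min_lambdaMin_pos hPc hP₀ hc))

theorem stateNorm_le_mul_exp {κ : ℝ} (hPc : Pc.PosDef) (hP₀ : P₀.PosDef) (hc : 0 < c)
    (hV : DecaysOn {u | t₀ ≤ u ∧ (u : EReal) < S} (fun _ => κ) (lyapV Pc P₀ c r s))
    (ht : t₀ ≤ t) (htS : (t : EReal) < S) :
    stateNorm r s t
      ≤ overshoot hPc hP₀ c * stateNorm r s t₀ * Real.exp (-(κ / 2 * (t - t₀))) := by
  have hm := min_lambdaMin_pos hPc hP₀ hc
  set m := min (lambdaMin hPc.isHermitian) (c * lambdaMin hP₀.isHermitian)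
  have hexp : Real.exp (-(κ * (t - t₀))) = Real.exp (-(κ / 2 * (t - t₀))) ^ 2 := by
    rw [← Real.exp_nat_mul]; congr 1; push_cast; ring
  calc stateNorm r s t ≤ √(lyapV Pc P₀ c r s t / m) := stateNorm_le_sqrt_lyapV_div hPc hP₀ hc
    _ ≤ √((frobNorm Pc + c * frobNorm P₀) * stateNorm r s t₀ ^ 2
          * Real.exp (-(κ * (t - t₀))) / m) := by
        gcongr
        refine (hV.le_mul_exp_of_const (Icc_subset_horizon htS) ht).trans ?_
        gcongr
        exact lyapV_le_mul_stateNorm_sq hc.le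
    _ = √((frobNorm Pc + c * frobNorm P₀) / m
          * (stateNorm r s t₀ * Real.exp (-(κ / 2 * (t - t₀)))) ^ 2) := by
        rw [hexp]; congr 1; ring
    _ = overshoot hPc hP₀ c * stateNorm r s t₀ * Real.exp (-(κ / 2 * (t - t₀))) := by
        rw [Real.sqrt_mul' _ (sq_nonneg _), overshoot, mul_assoc,
          Real.sqrt_sq (mul_nonneg (stateNorm_nonneg r s t₀) (Real.exp_pos _).le)]

theorem DecaysOn.stateNorm_le (hPc : Pc.PosDef) (hP₀ : P₀.PosDef) (hc : 0 < c)
    (htf : 0 ≤ tf) (hδ : 0 < δ) (hγ : 0 ≤ γ) (ht₀ : 0 ≤ t₀)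
    (hV : DecaysOn {u | t₀ ≤ u ∧ (u : EReal) < S} (fun u => γ * alphaSat tf δ u)
      (lyapV Pc P₀ c r s)) (ht : t₀ ≤ t) (htS : (t : EReal) < S) :
    stateNorm r s t ≤ overshoot hPc hP₀ c * stateNorm r s t₀
      * Real.exp (-(γ * (1 / (tf + δ)) / 2 * (t - t₀))) :=
  stateNorm_le_mul_exp hPc hP₀ hc
    (hV.mono_rate
      (fun _ hu => mul_le_mul_of_nonneg_left (one_div_le_alphaSat htf hδ (ht₀.trans hu.1)) hγ)
      fun _ _ => lyapV_nonneg hPc.posSemidef hP₀.posSemidef hc.le) ht htS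

theorem DecaysOn.trackingError_mem_closedBall (hPc : Pc.PosDef) (hP₀ : P₀.PosDef) (hc : 0 < c)
    (htf : 0 ≤ tf) (hδ : 0 < δ) (hγ : 0 ≤ γ) (hb : tf + δ ≤ b)
    (hV : DecaysOn {u | 0 ≤ u ∧ (u : EReal) < S} (fun u => γ * alphaSat tf δ u)
      (lyapV Pc P₀ c (gain b tf δ) s)) (ht : tf ≤ t) (htS : (t : EReal) < S) (k : Fin N) :
    trackingError s k t ∈ Metric.closedBall 0 (radius b c tf δ γ (lambdaMin hPc.isHermitian)
      (lambdaMin hP₀.isHermitian) (lyapV Pc P₀ c (gain b tf δ) s 0)) := by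
  have hm := min_lambdaMin_pos hPc hP₀ hc
  have hb0 : 0 < b := by linarith
  have hq : 0 ≤ δ / (tf + δ) := by positivity
  have hsqrt : √((δ / (tf + δ)) ^ γ) = (δ / (tf + δ)) ^ (γ / 2) := by
    rw [Real.sqrt_eq_rpow, ← Real.rpow_mul hq, mul_one_div]
  rw [mem_closedBall_zero_iff]
  calc ‖trackingError s k t‖ ≤ 2 * stateNorm (gain b tf δ) s t / (b / δ) := by
        rw [← gain_of_le (b := b) (δ := δ) ht]
        exact norm_trackingError_le (one_le_gain htf hδ hb (htf.trans ht))
    _ ≤ 2 * √(lyapV Pc P₀ c (gain b tf δ) s 0 * (δ / (tf + δ)) ^ γ /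
          min (lambdaMin hPc.isHermitian) (c * lambdaMin hP₀.isHermitian)) / (b / δ) := by
        gcongr
        refine (stateNorm_le_sqrt_lyapV_div hPc hP₀ hc).trans ?_
        gcongr
        exact hV.lyapV_le_mul_rpow hPc.posSemidef hP₀.posSemidef hc.le htf hδ hγ ht htS
    _ = _ := by
        rw [radius, Real.sqrt_div' _ hm.le, Real.sqrt_mul' _ (Real.rpow_nonneg hq γ), hsqrt]
        field_simp

theorem tendsto_infDist_of_mem {X : Type*} [PseudoMetricSpace X] {f : ℝ → X} {a u : ℝ} {K : Set X}
    (hu : u < a) (hf : ContinuousOn f (Icc u a)) (ha : f a ∈ K) :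
    Tendsto (fun t => Metric.infDist (f t) K) (𝓝[<] a) (𝓝 0) := by
  have h : Tendsto f (𝓝[<] a) (𝓝 (f a)) := by
    rw [← nhdsWithin_Ioo_eq_nhdsLT hu]
    exact (hf a (right_mem_Icc.2 hu.le)).mono_left (nhdsWithin_mono _ Ioo_subset_Icc_self)
  rw [← Metric.infDist_zero_of_mem ha]
  exact (Metric.continuous_infDist_pt K).continuousAt.tendsto.comp h

end Estimates

theorem SensitivityBound.mul_abs_sub_one_le {N : ℕ} {Δ : Fin N → ℝ} {θ : Fin N → ℝ → ℝ} {p : ℝ}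
    (hθ : SensitivityBound Δ θ) (hp : 0 ≤ p) (hΔ : ∀ k, Δ k ≤ 1 / p) (k : Fin N) (t : ℝ)
    (ht : 0 ≤ t) : p * |θ k t - 1| ≤ 1 := by
  obtain ⟨hlower, hupper⟩ := (hθ k).2 t ht
  calc p * |θ k t - 1| ≤ p * (1 / p) := by
        gcongr
        exact (abs_sub_le_iff.2 ⟨by linarith, by linarith⟩).trans (hΔ k)
    _ ≤ 1 := by rw [mul_one_div]; exact div_self_le_one p

end PrescribedTime

open PrescribedTime in
theorem theorem3_general {N n : ℕ} [Nonempty (Fin N)] [NeZero n]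
    (Gr : SimpleGraph (Fin N)) [DecidableRel Gr.Adj] (pin : Finset (Fin N)) (K G : Fin n → ℝ)
    (c₁ : ℝ) (hc₁ : 0 < c₁ ∧ c₁ < 1)
    (Pc P₀ : Matrix (Fin N × Fin n) (Fin N × Fin n) ℝ) (hPc : Pc.PosDef) (hP₀ : P₀.PosDef)
    (hPcA : (-(c₁ • (Pc * closedA Gr pin K + (closedA Gr pin K)ᵀ * Pc))
      - (2 : ℝ) • 1).PosSemidef)
    (hP₀A : (-(P₀ * observerA N G + (observerA N G)ᵀ * P₀) - 1).PosSemidef)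
    (ϱ : Fin N → Fin n → ℝ) (tf δ : ℝ) (htf : 0 < tf) (hδ : 0 < δ) :
    ∃ c : ℝ, 0 < c ∧ ∀ γ : ℝ, 0 < γ → ∃ b : ℝ, tf + δ ≤ b ∧
      (∃ β : ℝ → ℝ → ℝ, IsClassKL β ∧
        ∀ (F₀ : ℝ → (Fin n → ℝ) → Fin n → ℝ) (F : Fin N → ℝ → (Fin n → ℝ) → Fin n → ℝ)
          (θ : Fin N → ℝ → ℝ) (s : Signals N n) (t₀ : ℝ) (S : EReal),
          IsLeaderTrajectory F₀ s.x₀ →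
          GrowthBound ϱ F₀ F s.x₀ →
          (∀ k t, 0 ≤ t → frobNorm (Pc * gainA N G) * |θ k t - 1| ≤ 1) → 0 ≤ t₀ →
          IsClosedLoop Gr pin K G F₀ F θ (gain b tf δ) t₀ S s →
          ∀ t, t₀ ≤ t → (t : EReal) < S →
            stateNorm (gain b tf δ) s t
              ≤ β (stateNorm (gain b tf δ) s t₀) (t - t₀)) ∧
      (∀ (F₀ : ℝ → (Fin n → ℝ) → Fin n → ℝ) (F : Fin N → ℝ → (Fin n → ℝ) → Fin n → ℝ)
          (θ : Fin N → ℝ → ℝ) (s : Signals N n) (S : EReal),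
          IsLeaderTrajectory F₀ s.x₀ →
          GrowthBound ϱ F₀ F s.x₀ →
          (∀ k t, 0 ≤ t → frobNorm (Pc * gainA N G) * |θ k t - 1| ≤ 1) → (tf : EReal) < S →
          IsClosedLoop Gr pin K G F₀ F θ (gain b tf δ) 0 S s →
          ∀ k,
            Tendsto (fun t => Metric.infDist (trackingError s k t)
              (Metric.closedBall 0 (radius b c tf δ γ
                (lambdaMin hPc.isHermitian)
                (lambdaMin hP₀.isHermitian)
                (lyapV Pc P₀ c (gain b tf δ) s 0))))
              (𝓝[<] tf) (𝓝 0) ∧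
            ∀ t, tf ≤ t → (t : EReal) < S →
              trackingError s k t ∈
                Metric.closedBall 0 (radius b c tf δ γ
                  (lambdaMin hPc.isHermitian)
                  (lambdaMin hP₀.isHermitian)
                  (lyapV Pc P₀ c (gain b tf δ) s 0))) := by
  set c := observerWeight (frobNorm (Pc * gainA N G)) (c₁⁻¹ - 1) with hc
  have hc0 : 0 < c := observerWeight_pos _ (sub_pos.2 ((one_lt_inv₀ hc₁.1).2 hc₁.2))
  refine ⟨c, hc0, fun γ hγ => ?_⟩
  obtain ⟨b, hb, hdecay⟩ := exists_gain_decaysOn_lyapV hc₁ hPc.isHermitian hP₀.isHermitian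
    hPcA hP₀A hc ϱ htf.le hδ hγ.le
  refine ⟨b, hb, ⟨_, isClassKL_mul_exp (overshoot_pos hPc hP₀ hc0)
      (κ := γ * (1 / (tf + δ)) / 2) (by positivity), ?_⟩, ?_⟩
  · intro F₀ F θ s t₀ S _ hF hθ ht₀ hcl t ht htS
    exact (hdecay F₀ F θ s t₀ S hF hθ ht₀ hcl).stateNorm_le hPc hP₀ hc0 htf.le hδ hγ.le ht₀ ht htS
  · intro F₀ F θ s S _ hF hθ htfS hcl k
    have hV := hdecay F₀ F θ s 0 S hF hθ le_rfl hcl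
    have hmem := fun t (ht : tf ≤ t) (htS : (t : EReal) < S) =>
      hV.trackingError_mem_closedBall hPc hP₀ hc0 htf.le hδ hγ.le hb ht htS k
    have hcont := continuousOn_trackingError (continuous_gain hδ).continuousOn
      (fun t ht => (one_pos.trans_le (one_le_gain htf.le hδ hb ht.1)).ne') (hcl.1 k)
    exact ⟨tendsto_infDist_of_mem htf (hcont.mono (Icc_subset_horizon htfS)) (hmem tf le_rfl htfS),
      hmem⟩

theorem theorem3 {N n : ℕ} [NeZero n]
    (Gr : SimpleGraph (Fin N)) [DecidableRel Gr.Adj] (hGr : Gr.Connected)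
    (pin : Finset (Fin N)) (hpin : pin.Nonempty)
    (K G : Fin n → ℝ)
    (hK : PrescribedTime.IsHurwitz (PrescribedTime.closedA Gr pin K))
    (hG : PrescribedTime.IsHurwitz (PrescribedTime.observerA N G))
    (c₁ : ℝ) (hc₁ : 0 < c₁ ∧ c₁ < 1)
    (Pc P₀ : Matrix (Fin N × Fin n) (Fin N × Fin n) ℝ) (hPc : Pc.PosDef) (hP₀ : P₀.PosDef)
    (hPcA : (-(c₁ • (Pc * PrescribedTime.closedA Gr pin K
        + (PrescribedTime.closedA Gr pin K)ᵀ * Pc)) - (2 : ℝ) • 1).PosSemidef)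
    (hP₀A : (-(P₀ * PrescribedTime.observerA N G
        + (PrescribedTime.observerA N G)ᵀ * P₀) - 1).PosSemidef)
    (ϱ : Fin N → Fin n → ℝ)
    (Δ : Fin N → ℝ) (hΔ : ∀ k, 0 < Δ k ∧ Δ k < 1)
    (hΔmax : ∀ k, Δ k ≤ 1 / PrescribedTime.frobNorm (Pc * PrescribedTime.gainA N G))
    (tf δ : ℝ) (htf : 0 < tf) (hδ : 0 < δ) :
    ∃ c : ℝ, 0 < c ∧ ∀ γ : ℝ, 0 < γ → ∃ b : ℝ, tf + δ ≤ b ∧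
      (∃ β : ℝ → ℝ → ℝ, PrescribedTime.IsClassKL β ∧
        ∀ (F₀ : ℝ → (Fin n → ℝ) → Fin n → ℝ) (F : Fin N → ℝ → (Fin n → ℝ) → Fin n → ℝ)
          (θ : Fin N → ℝ → ℝ) (s : PrescribedTime.Signals N n) (t₀ : ℝ) (S : EReal),
          PrescribedTime.IsLeaderTrajectory F₀ s.x₀ →
          PrescribedTime.GrowthBound ϱ F₀ F s.x₀ →
          PrescribedTime.SensitivityBound Δ θ → 0 ≤ t₀ →
          PrescribedTime.IsClosedLoop Gr pin K G F₀ F θ (PrescribedTime.gain b tf δ) t₀ S s →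
          ∀ t, t₀ ≤ t → (t : EReal) < S →
            PrescribedTime.stateNorm (PrescribedTime.gain b tf δ) s t
              ≤ β (PrescribedTime.stateNorm (PrescribedTime.gain b tf δ) s t₀) (t - t₀)) ∧
      (∀ (F₀ : ℝ → (Fin n → ℝ) → Fin n → ℝ) (F : Fin N → ℝ → (Fin n → ℝ) → Fin n → ℝ)
          (θ : Fin N → ℝ → ℝ) (s : PrescribedTime.Signals N n) (S : EReal),
          PrescribedTime.IsLeaderTrajectory F₀ s.x₀ →
          PrescribedTime.GrowthBound ϱ F₀ F s.x₀ →
          PrescribedTime.SensitivityBound Δ θ → (tf : EReal) < S →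
          PrescribedTime.IsClosedLoop Gr pin K G F₀ F θ (PrescribedTime.gain b tf δ) 0 S s →
          ∀ k,
            Tendsto (fun t => Metric.infDist (PrescribedTime.trackingError s k t)
              (Metric.closedBall 0 (PrescribedTime.radius b c tf δ γ
                (PrescribedTime.lambdaMin hPc.isHermitian)
                (PrescribedTime.lambdaMin hP₀.isHermitian)
                (PrescribedTime.lyapV Pc P₀ c (PrescribedTime.gain b tf δ) s 0))))
              (𝓝[<] tf) (𝓝 0) ∧
            ∀ t, tf ≤ t → (t : EReal) < S →
              PrescribedTime.trackingError s k t ∈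
                Metric.closedBall 0 (PrescribedTime.radius b c tf δ γ
                  (PrescribedTime.lambdaMin hPc.isHermitian)
                  (PrescribedTime.lambdaMin hP₀.isHermitian)
                  (PrescribedTime.lyapV Pc P₀ c (PrescribedTime.gain b tf δ) s 0))) := by
  have := hGr.nonempty
  obtain ⟨c, hc, H⟩ := theorem3_general Gr pin K G c₁ hc₁ Pc P₀ hPc hP₀ hPcA hP₀A ϱ tf δ htf hδ
  refine ⟨c, hc, fun γ hγ => ?_⟩
  obtain ⟨b, hb, ⟨β, hβ, hstab⟩, htrack⟩ := H γ hγ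
  have hp := PrescribedTime.frobNorm_nonneg (Pc * PrescribedTime.gainA N G)
  exact ⟨b, hb,
    ⟨β, hβ, fun F₀ F θ s t₀ S hx₀ hF hθ =>
      hstab F₀ F θ s t₀ S hx₀ hF (hθ.mul_abs_sub_one_le hp hΔmax)⟩,
    fun F₀ F θ s S hx₀ hF hθ => htrack F₀ F θ s S hx₀ hF (hθ.mul_abs_sub_one_le hp hΔmax)⟩
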